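/- **Setting.** Let $L>0$ and let $q:\mathbb R\to\mathbb C$ be $L$-periodic with $q\in C^2([0,L])$. Let $Y(x,z)$ be the principal matrix solution ($Y(0,z)=I$) of $$v_x=\Big(-iz\sigma_3+\begin{pmatrix}0&q(x)\\-\overline{q(x)}&0\end{pmatrix}\Big)v,$$ let $\Delta(z)=\tfrac12\operatorname{tr}Y(L,z)$, and let $\tilde Y=UYU^{-1}$ with $U=\tfrac1{\sqrt2}\begin{pmatrix}1&1\\-i&i\end{pmatrix}$. Let $\Sigma$ be the Lax spectrum, i.e. the set of $z$ for which the system has a bounded nontrivial solution on $\mathbb R$. Let $(\Delta^2-1)^{1/2}$ be the square root that is holomorphic off $\Sigma$ and asymptotic to $\Delta$ as $|\operatorname{Im}z|\to\infty$ (with any choice of values on $\Sigma$), and put $\rho=\Delta-(\Delta^2-1)^{1/2}$. Let $\pi_j=j\pi/L$ for $j\ne0$ and $\pi_0=1/L$. The main eigenvalues $(\zeta_j)_{j\in\mathbb Z}$ are the zeros of $\Delta^2-1$, and the Dirichlet eigenvalues $(\mu_j)_{j\in\mathbb Z}$ are the zeros of $\tilde y_{12}(L,\cdot)$, both listed with multiplicity.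 They are labelled so that $\zeta_{2j-1}=\overline{\zeta_{2j}}$ and $\operatorname{Im}\zeta_{2j}\ge0$; for all but finitely many $j$, $\zeta_{2j}$ and $\mu_j$ lie in $\{|z-j\pi/L|<\pi/(4L)\}$; and $\mu_j=\zeta_{2j}$ whenever $\zeta_{2j}=\zeta_{2j-1}$. Let $\Sigma^o=\Sigma\setminus\{\zeta_j\}$. If $\mu_k\notin\Sigma^o$, let $\nu_k=-\operatorname{sgn}\log|\tilde y_{22}(L,\mu_k)|$. If $\mu_k\in\Sigma^o$, let $\nu_k=1$ when $\tilde y_{22}(L,\mu_k)=\rho(\mu_k)$ and $\nu_k=-1$ when $\tilde y_{22}(L,\mu_k)=1/\rho(\mu_k)$. Let $G=\{j:\zeta_{2j}\neq\zeta_{2j-1}\}$. For $k\in G$ write $E_{2k}=\zeta_{2k}$, $E_{2k-1}=\zeta_{2k-1}$, $\mathring\mu_k=\mu_k$. The spectral data are $S(q)=\{E_{2k-1},E_{2k},\mathring\mu_k,\nu_k\}_{k\in G}$. Infinite products over $j$ are limits of the products over $|j|\le N$ as $N\to\infty$. Put $$f^0(z)=-\prod_{\nu_j=0}\frac{\mu_j-z}{\pi_j},\qquad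 f^{\pm}(z)=\prod_{\nu_j=\pm1}\frac{\mu_j-z}{\pi_j},\qquad b=\frac{(f^0)^{1/2}}{(\Delta^2-1)^{1/4}},$$ with any choice of $(f^0)^{1/2}$ and of a square root $(\Delta^2-1)^{1/4}$ of $(\Delta^2-1)^{1/2}$. For $z\notin\Sigma$ put $B=ib\,\operatorname{diag}(f^-,f^+)$ in $\mathbb C^+$ and $B=b\,\operatorname{diag}(f^+,f^-)$ in $\mathbb C^-$. **Claim.** Assume that for each sign $\pm$ the sums $\sum_{0<|j|\le N,\ \nu_j=\pm1}1/j$ converge as $N\to\infty$ (which holds if only finitely many $\nu_j$ are nonzero). Then: 1. The products defining $f^0$ and $f^\pm$ converge for every $z\in\mathbb C$, and $B$ is determined by $S(q)$. Explicitly, for every $z\in\mathbb C$, $$f^{\pm}(z)=\prod_{k\in G,\ \nu_k=\pm1}\frac{\mathring\mu_k-z}{\pi_k},$$ and for every $z\notin\Sigma$ both products in $$b^4(z)=-\prod_{k\in G,\ \nu_k=0}\frac{(\mathring\mu_k-z)^2}{(E_{2k}-z)(E_{2k-1}-z)}\ \prod_{k\in G,\ \nu_k\ne0}\frac{\pi_k^2}{(E_{2k}-z)(E_{2k-1}-z)}$$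 converge and the identity holds. In particular, if two potentials of period $L$ have the same spectral data, then at every $z$ outside both Lax spectra their matrices $B(z)$ agree up to a fourth root of unity (the choice of branches in $b$). 2. For $z\in\mathbb C^\pm\setminus\Sigma$, $$\det B(z)=\mp\frac{\tilde y_{12}(L,z)}{(\Delta^2(z)-1)^{1/2}}.$$ Moreover, if $q$ is real and even, then (without the assumption on the sums) $B(z)$ is a scalar multiple of the identity for every $z\notin\Sigma$. -/

import Mathlib

open Filter Topology Complex

noncomputable section

namespace ZS

/-- Third Pauli matrix. -/
def sigma3 : Matrix (Fin 2) (Fin 2) ℂ := !![1, 0; 0, -1]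

/-- The potential matrix `Q(x)`, with the minus sign of the focusing (non-self-adjoint) case. -/
def potentialMatrix (q : ℝ → ℂ) (x : ℝ) : Matrix (Fin 2) (Fin 2) ℂ :=
  !![0, q x; -(starRingEnd ℂ) (q x), 0]

/-- Coefficient matrix `-i z σ₃ + Q(x)` of the Zakharov-Shabat system `v_x = (-i z σ₃ + Q) v`,
which is equivalent to `i σ₃ (∂_x - Q) v = z v`. -/
def zsMatrix (q : ℝ → ℂ) (z : ℂ) (x : ℝ) : Matrix (Fin 2) (Fin 2) ℂ :=
  (-(I * z)) • sigma3 + potentialMatrix q x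

/-- `v` solves the Zakharov-Shabat system on the whole line. -/
def IsSolution (q : ℝ → ℂ) (z : ℂ) (v : ℝ → Fin 2 → ℂ) : Prop :=
  ∀ (x : ℝ) (i : Fin 2),
    HasDerivAt (fun y => v y i) (((zsMatrix q z x).mulVec (v x)) i) x

/-- `Y` is the principal matrix solution: every `Y(·,z)` solves the system and `Y(0,z) = 1`. -/
def IsPrincipalSolution (q : ℝ → ℂ) (Y : ℝ → ℂ → Matrix (Fin 2) (Fin 2) ℂ) : Prop :=
  ∀ z : ℂ, Y 0 z = 1 ∧ ∀ (x : ℝ) (i k : Fin 2),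
    HasDerivAt (fun y => Y y z i k) ((zsMatrix q z x * Y x z) i k) x

/-- The Lax spectrum: those `z` for which there is a bounded nontrivial solution. -/
def laxSpectrum (q : ℝ → ℂ) : Set ℂ :=
  {z | ∃ v : ℝ → Fin 2 → ℂ, IsSolution q z v ∧ v ≠ 0 ∧ ∃ C : ℝ, ∀ x, ‖v x‖ ≤ C}

/-- The constant unitary matrix `U` of the modified Zakharov-Shabat system. -/
def U : Matrix (Fin 2) (Fin 2) ℂ := (((1 / Real.sqrt 2 : ℝ)) : ℂ) • !![1, 1; -I, I]

/-- Floquet discriminant: half the trace of the monodromy matrix `M(z) = Y(L,z)`. -/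
def discriminant (L : ℝ) (Y : ℝ → ℂ → Matrix (Fin 2) (Fin 2) ℂ) (z : ℂ) : ℂ :=
  (Y L z).trace / 2

/-- Modified fundamental matrix at `x = L`, that is `U Y(L,z) U⁻¹`. -/
def modMonodromy (L : ℝ) (Y : ℝ → ℂ → Matrix (Fin 2) (Fin 2) ℂ) (z : ℂ) :
    Matrix (Fin 2) (Fin 2) ℂ :=
  U * Y L z * U⁻¹

/-- Normalizing constants of the canonical products: `π_j = jπ/L` for `j ≠ 0`, `π_0 = 1/L`. -/
def piNorm (L : ℝ) (j : ℤ) : ℂ :=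
  if j = 0 then ((1 / L : ℝ) : ℂ) else ((Real.pi * j / L : ℝ) : ℂ)

/-- The two-sided sequence `a` lists the zeros of `f`, each as often as its multiplicity. -/
def EnumeratesZeros (f : ℂ → ℂ) (a : ℤ → ℂ) : Prop :=
  ∀ w : ℂ, {j : ℤ | a j = w}.encard = analyticOrderAt f w

/-- An `L`-periodic potential, with its principal solution, the branch of `(Δ² - 1)^{1/2}`, and a
labelling of its main and Dirichlet spectra. -/
structure FloquetData (L : ℝ) where
  /-- the potential -/
  q : ℝ → ℂ
  periodic : ∀ x, q (x + L) = q x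
  smooth : ContDiffOn ℝ 2 q (Set.Icc 0 L)
  /-- the principal matrix solution -/
  Y : ℝ → ℂ → Matrix (Fin 2) (Fin 2) ℂ
  principal : IsPrincipalSolution q Y
  /-- the square root of `Δ² - 1` with branch cut on the Lax spectrum which is asymptotic to `Δ`
  as `|Im z| → ∞`. This pins it off the Lax spectrum; on the cut either of the two values is
  allowed, in particular that of a one-sided limit. -/
  r : ℂ → ℂ
  r_sq : ∀ z, r z ^ 2 = discriminant L Y z ^ 2 - 1
  r_holo : DifferentiableOn ℂ r (laxSpectrum q)ᶜ
  r_asymp : Tendsto (fun z => r z / discriminant L Y z)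
    (comap (fun z : ℂ => |z.im|) atTop) (𝓝 1)
  /-- the main eigenvalues -/
  zeta : ℤ → ℂ
  zeta_enum : EnumeratesZeros (fun z => discriminant L Y z ^ 2 - 1) zeta
  zeta_conj : ∀ j : ℤ, zeta (2 * j - 1) = (starRingEnd ℂ) (zeta (2 * j))
  zeta_im : ∀ j : ℤ, 0 ≤ (zeta (2 * j)).im
  /-- this fixes the origin of the labels: the `j`-th pair lies in the disc `D_j` for large `|j|` -/
  zeta_disc : ∀ᶠ j : ℤ in cofinite,
    ‖zeta (2 * j) - ((Real.pi * j / L : ℝ) : ℂ)‖ < Real.pi / (4 * L)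
  /-- the Dirichlet eigenvalues with base point `0`: the zeros of `ỹ₁₂(L,·)` -/
  mu : ℤ → ℂ
  mu_enum : EnumeratesZeros (fun z => modMonodromy L Y z 0 1) mu
  mu_disc : ∀ᶠ j : ℤ in cofinite,
    ‖mu j - ((Real.pi * j / L : ℝ) : ℂ)‖ < Real.pi / (4 * L)
  /-- at a degenerate (hence real) pair of main eigenvalues the Dirichlet eigenvalue which lies
  there carries the same label -/
  mu_degenerate : ∀ j : ℤ, zeta (2 * j) = zeta (2 * j - 1) → mu j = zeta (2 * j)

/-- Spectral data `{E_{2k-1}, E_{2k}, μ_k, ν_k}` labelled by a set of integers `idx`; the first and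
second components of `E k` are `E_{2k-1}` and `E_{2k}`. -/
structure SpectralData where
  idx : Set ℤ
  E : idx → ℂ × ℂ
  mu : idx → ℂ
  nu : idx → ℤ

namespace SpectralData

open Classical in
/-- Product of `F k` over the labels `k ∈ idx` with `|k| ≤ N`. -/
def partialProd (S : SpectralData) (F : S.idx → ℂ) (N : ℕ) : ℂ :=
  ∏ j ∈ Finset.Icc (-(N : ℤ)) N, if h : j ∈ S.idx then F ⟨j, h⟩ else 1

/-- Factors of the product for `f^±` (`ε = ±1`). -/
def fFactor (S : SpectralData) (L : ℝ) (ε : ℤ) (z : ℂ) (k : S.idx) : ℂ :=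
  if S.nu k = ε then (S.mu k - z) / piNorm L k else 1

/-- Factors of the product over `ν_k = 0` in the formula for `b⁴`. -/
def bFactorZero (S : SpectralData) (z : ℂ) (k : S.idx) : ℂ :=
  if S.nu k = 0 then (S.mu k - z) ^ 2 / (((S.E k).2 - z) * ((S.E k).1 - z)) else 1

/-- Factors of the product over `ν_k ≠ 0` in the formula for `b⁴`. -/
def bFactorNonzero (S : SpectralData) (L : ℝ) (z : ℂ) (k : S.idx) : ℂ :=
  if S.nu k ≠ 0 then piNorm L k ^ 2 / (((S.E k).2 - z) * ((S.E k).1 - z)) else 1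

end SpectralData

namespace FloquetData

variable {L : ℝ}

/-- The Lax spectrum of the potential. -/
def spectrum (D : FloquetData L) : Set ℂ := laxSpectrum D.q

/-- The entry `ỹ₁₂(L,z)`. -/
def y12 (D : FloquetData L) (z : ℂ) : ℂ := modMonodromy L D.Y z 0 1

/-- The entry `ỹ₂₂(L,z)`. -/
def y22 (D : FloquetData L) (z : ℂ) : ℂ := modMonodromy L D.Y z 1 1

/-- The Floquet multiplier `ρ = Δ - (Δ² - 1)^{1/2}`. -/
def rho (D : FloquetData L) (z : ℂ) : ℂ := discriminant L D.Y z - D.r z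

/-- The Lax spectrum without the main eigenvalues. -/
def spectrumInterior (D : FloquetData L) : Set ℂ := D.spectrum \ Set.range D.zeta

open Classical in
/-- The sign `ν_k` of the Dirichlet eigenvalue `μ_k`. In the first case `ỹ₂₂(L,μ_k)` is one of the
two distinct numbers `ρ(μ_k)` and `1/ρ(μ_k)`. -/
def nu (D : FloquetData L) (k : ℤ) : ℤ :=
  if D.mu k ∈ D.spectrumInterior then
    if D.y22 (D.mu k) = D.rho (D.mu k) then 1 else -1
  else -((SignType.sign (Real.log ‖D.y22 (D.mu k)‖) : SignType) : ℤ)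

/-- Product of `(μ_j - z)/π_j` over `|j| ≤ N` with `ν_j = ε`. -/
def dirichletPartial (D : FloquetData L) (ε : ℤ) (z : ℂ) (N : ℕ) : ℂ :=
  ∏ j ∈ (Finset.Icc (-(N : ℤ)) N).filter (fun j => D.nu j = ε), (D.mu j - z) / piNorm L j

/-- The infinite product of `(μ_j - z)/π_j` over `ν_j = ε` (principal value). -/
def dirichletProd (D : FloquetData L) (ε : ℤ) (z : ℂ) : ℂ :=
  limUnder atTop (D.dirichletPartial ε z)

def f0 (D : FloquetData L) (z : ℂ) : ℂ := -D.dirichletProd 0 z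

def fPlus (D : FloquetData L) (z : ℂ) : ℂ := D.dirichletProd 1 z

def fMinus (D : FloquetData L) (z : ℂ) : ℂ := D.dirichletProd (-1) z

/-- `s` is a choice of `(f⁰)^{1/2}` off the Lax spectrum. -/
def IsRootF0 (D : FloquetData L) (s : ℂ → ℂ) : Prop :=
  ∀ z, z ∉ D.spectrum → s z ^ 2 = D.f0 z

/-- `t` is a choice of `(Δ² - 1)^{1/4}` off the Lax spectrum: a square root of the fixed branch of
`(Δ² - 1)^{1/2}`. -/
def IsFourthRoot (D : FloquetData L) (t : ℂ → ℂ) : Prop :=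
  ∀ z, z ∉ D.spectrum → t z ^ 2 = D.r z

/-- The matrix `B(z)`, for `z` off the Lax spectrum (which contains the real axis), where
`b = (f⁰)^{1/2} / (Δ² - 1)^{1/4}`. -/
def B (D : FloquetData L) (b : ℂ → ℂ) (z : ℂ) : Matrix (Fin 2) (Fin 2) ℂ :=
  if 0 < z.im then (b z * I) • Matrix.diagonal ![D.fMinus z, D.fPlus z]
  else b z • Matrix.diagonal ![D.fPlus z, D.fMinus z]

/-- The spectral data `S(q)`: the labels are those of the nondegenerate pairs of main
eigenvalues. -/
def spectralData (D : FloquetData L) : SpectralData where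
  idx := {j : ℤ | D.zeta (2 * j) ≠ D.zeta (2 * j - 1)}
  E := fun k => (D.zeta (2 * (k : ℤ) - 1), D.zeta (2 * (k : ℤ)))
  mu := fun k => D.mu k
  nu := fun k => D.nu k

/-- For `ε = ±1` the sum of `1/j` over `j ≠ 0` with `ν_j = ε` converges in the principal value
sense (the term with `j = 0` vanishes, as `0⁻¹ = 0`). Since `(μ_j - z)/π_j = 1 - zL/(πj) + O(1/j²)`,
this says that the products over `ν_j = ±1` converge. It holds whenever only finitely many `ν_j`
are nonzero. -/
def BalancedSigns (D : FloquetData L) : Prop :=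
  ∀ ε : ℤ, (ε = 1 ∨ ε = -1) → ∃ l : ℝ, Tendsto (fun N : ℕ =>
    ∑ j ∈ (Finset.Icc (-(N : ℤ)) N).filter (fun j => D.nu j = ε), ((j : ℝ))⁻¹) atTop (𝓝 l)

end FloquetData

end ZS

end

noncomputable section

namespace ZS

/-! Everything rests on two product representations off the Lax spectrum: the product of (μ_j -
z)/π_j equals -ỹ₁₂(L,z) (`tendsto_prod_mu`), and the product over pairs of (ζ_{2j} - z)(ζ_{2j-1} -
z)/π_j² equals -(Δ² - 1) (`tendsto_prod_zeta`). Both are cases of `tendsto_canonicalProduct`, which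
needs three inputs: the function is entire, it equals c sin(zL)^m up to a relative error O(1/|z|) on
large squares, and its zeros are within O(|j|^(-1/2)) of jπ/L. Analyticity comes from Wronskians of
solutions at two spectral parameters, the asymptotics from one integration by parts, and the
location of the zeros from evaluating the asymptotics at the zeros themselves. The product formula
then follows by dividing finitely many zeros out of both the function and the sine and applying the
maximum principle to the quotient on a square.

Products over one sign class converge only conditionally. Each factor is 1 + α/j + O(|j|^(-3/2)), so
convergence follows from that of the sums of 1/j over the class (`NearOne.exists_tendsto_prod`).

The restriction to nondegenerate labels rests on (ỹ₂₂ - Δ)² = Δ² - 1 at a Dirichlet eigenvalue. At a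
degenerate pair this forces ν = 0, so such a label never enters f^±; in b⁴ its factor over ν = 0 is
1 because μ_j equals both main eigenvalues. Splitting the Dirichlet product by sign gives the
determinant, and comparing squares of the ν = 0 product with the product for Δ² - 1 gives b⁴. For
real even q the reflection symmetry yields ỹ₂₂ = Δ at each μ_k, so every sign vanishes and f^± = 1.
-/

/-- The components `u`, `v` form a solution of the Zakharov-Shabat system. -/
def IsColumn (q : ℝ → ℂ) (z : ℂ) (u v : ℝ → ℂ) : Prop :=
  (∀ x, HasDerivAt u (-(I * z) * u x + q x * v x) x) ∧
    ∀ x, HasDerivAt v (I * z * v x - (starRingEnd ℂ) (q x) * u x) x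

/-! ### Energy bounds and symmetries of solutions. -/

namespace IsColumn

variable {q : ℝ → ℂ} {z : ℂ} {u v : ℝ → ℂ}

/-- The potential matrix is skew-Hermitian and drops out of the derivative, so growth is governed by
Im z alone. This is what makes all later bounds uniform in q and gives uniqueness as a by-product.
-/
theorem hasDerivAt_energy (h : IsColumn q z u v) (x : ℝ) :
    HasDerivAt (fun x => ‖u x‖ ^ 2 + ‖v x‖ ^ 2) (2 * z.im * (‖u x‖ ^ 2 - ‖v x‖ ^ 2)) x := by
  refine ((h.1 x).norm_sq.fun_add (h.2 x).norm_sq).congr_deriv ?_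
  simp only [Complex.inner, ← Complex.normSq_eq_norm_sq, Complex.normSq_apply]
  simp
  ring

theorem energy_le_of_nonneg (h : IsColumn q z u v) {x : ℝ} (hx : 0 ≤ x) :
    ‖u x‖ ^ 2 + ‖v x‖ ^ 2 ≤ Real.exp (2 * |z.im| * x) * (‖u 0‖ ^ 2 + ‖v 0‖ ^ 2) := by
  have hd : ∀ y, HasDerivAt (fun x => Real.exp (-(2 * |z.im| * x)) * (‖u x‖ ^ 2 + ‖v x‖ ^ 2))
      (Real.exp (-(2 * |z.im| * y)) * -(2 * |z.im|) * (‖u y‖ ^ 2 + ‖v y‖ ^ 2) +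
        Real.exp (-(2 * |z.im| * y)) * (2 * z.im * (‖u y‖ ^ 2 - ‖v y‖ ^ 2))) y := fun y => by
    have h1 : HasDerivAt (fun x : ℝ => -(2 * |z.im| * x)) (-(2 * |z.im|)) y := by
      simpa using ((hasDerivAt_id y).const_mul (2 * |z.im|)).fun_neg
    exact h1.exp.mul (h.hasDerivAt_energy y)
  have hanti := antitone_of_hasDerivAt_nonpos hd (fun y => by
    have e : Real.exp (-(2 * |z.im| * y)) * -(2 * |z.im|) * (‖u y‖ ^ 2 + ‖v y‖ ^ 2) +
        Real.exp (-(2 * |z.im| * y)) * (2 * z.im * (‖u y‖ ^ 2 - ‖v y‖ ^ 2)) =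
        -(2 * Real.exp (-(2 * |z.im| * y)) * ((|z.im| - z.im) * ‖u y‖ ^ 2 +
          (|z.im| + z.im) * ‖v y‖ ^ 2)) := by ring
    simp only [Pi.zero_apply]
    rw [e, neg_nonpos]
    have h1 := sub_nonneg.2 (le_abs_self z.im)
    have h2 : 0 ≤ |z.im| + z.im := by linarith [neg_abs_le z.im]
    positivity)
  have := hanti hx
  simp only [mul_zero, neg_zero, Real.exp_zero, one_mul] at this
  calc ‖u x‖ ^ 2 + ‖v x‖ ^ 2 = Real.exp (2 * |z.im| * x) *
        (Real.exp (-(2 * |z.im| * x)) * (‖u x‖ ^ 2 + ‖v x‖ ^ 2)) := by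
        rw [← mul_assoc, ← Real.exp_add]; simp
    _ ≤ _ := by gcongr

/-- Reflection `x ↦ -x` exchanges the two components. -/
theorem reflect (h : IsColumn q z u v) :
    IsColumn (fun x => (starRingEnd ℂ) (q (-x))) z (fun x => v (-x)) (fun x => u (-x)) := by
  constructor
  · intro x
    refine ((h.2 (-x)).scomp x (hasDerivAt_neg x)).congr_deriv ?_
    simp
    ring
  · intro x
    refine ((h.1 (-x)).scomp x (hasDerivAt_neg x)).congr_deriv ?_
    simp
    ring

theorem energy_le (h : IsColumn q z u v) (x : ℝ) :
    ‖u x‖ ^ 2 + ‖v x‖ ^ 2 ≤ Real.exp (2 * |z.im| * |x|) * (‖u 0‖ ^ 2 + ‖v 0‖ ^ 2) := by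
  rcases le_total 0 x with hx | hx
  · rw [abs_of_nonneg hx]; exact h.energy_le_of_nonneg hx
  · have := h.reflect.energy_le_of_nonneg (neg_nonneg.2 hx)
    rw [abs_of_nonpos hx]
    simp only [neg_neg, neg_zero] at this
    linarith

theorem eq_zero (h : IsColumn q z u v) (hu : u 0 = 0) (hv : v 0 = 0) (x : ℝ) :
    u x = 0 ∧ v x = 0 := by
  have := h.energy_le x
  simp only [hu, hv, norm_zero] at this
  have h1 := sq_nonneg ‖u x‖
  have h2 := sq_nonneg ‖v x‖
  constructor <;> rw [← norm_eq_zero, ← sq_eq_zero_iff] <;> linarith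

theorem norm_le (h : IsColumn q z u v) (h0 : ‖u 0‖ ^ 2 + ‖v 0‖ ^ 2 ≤ 1) (x : ℝ) :
    ‖u x‖ ≤ Real.exp (|z.im| * |x|) ∧ ‖v x‖ ≤ Real.exp (|z.im| * |x|) := by
  have h1 : ‖u x‖ ^ 2 + ‖v x‖ ^ 2 ≤ Real.exp (|z.im| * |x|) ^ 2 := by
    rw [← Real.exp_nat_mul]
    refine (h.energy_le x).trans ?_
    have : Real.exp (2 * |z.im| * |x|) * (‖u 0‖ ^ 2 + ‖v 0‖ ^ 2) ≤
      Real.exp (2 * |z.im| * |x|) * 1 := by gcongr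
    simpa [mul_assoc] using this
  have h2 := sq_nonneg ‖u x‖
  have h3 := sq_nonneg ‖v x‖
  exact ⟨(sq_le_sq₀ (norm_nonneg _) (Real.exp_nonneg _)).1 (by linarith),
    (sq_le_sq₀ (norm_nonneg _) (Real.exp_nonneg _)).1 (by linarith)⟩

theorem sub {u' v' : ℝ → ℂ} (h : IsColumn q z u v) (h' : IsColumn q z u' v') :
    IsColumn q z (fun x => u x - u' x) (fun x => v x - v' x) := by
  constructor <;> intro x
  · exact ((h.1 x).fun_sub (h'.1 x)).congr_deriv (by ring)
  · exact ((h.2 x).fun_sub (h'.2 x)).congr_deriv (by ring)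

theorem add {u' v' : ℝ → ℂ} (h : IsColumn q z u v) (h' : IsColumn q z u' v') :
    IsColumn q z (fun x => u x + u' x) (fun x => v x + v' x) := by
  constructor <;> intro x
  · exact ((h.1 x).fun_add (h'.1 x)).congr_deriv (by ring)
  · exact ((h.2 x).fun_add (h'.2 x)).congr_deriv (by ring)

theorem mul_const (h : IsColumn q z u v) (c : ℂ) :
    IsColumn q z (fun x => u x * c) (fun x => v x * c) := by
  constructor <;> intro x
  · exact ((h.1 x).mul_const c).congr_deriv (by ring)
  · exact ((h.2 x).mul_const c).congr_deriv (by ring)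

theorem translate (h : IsColumn q z u v) {L : ℝ} (hq : ∀ x, q (x + L) = q x) :
    IsColumn q z (fun x => u (x + L)) (fun x => v (x + L)) := by
  constructor <;> intro x
  · simpa [hq] using (h.1 (x + L)).comp_add_const x L
  · simpa [hq] using (h.2 (x + L)).comp_add_const x L

theorem eq_of_initial {u' v' : ℝ → ℂ} (h : IsColumn q z u v) (h' : IsColumn q z u' v')
    (hu : u 0 = u' 0) (hv : v 0 = v' 0) (x : ℝ) : u x = u' x ∧ v x = v' x := by
  have := (h.sub h').eq_zero (by simp [hu]) (by simp [hv]) x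
  exact ⟨sub_eq_zero.1 this.1, sub_eq_zero.1 this.2⟩

/-- Exchanging the components amounts to `z ↦ -z`, `q ↦ -q̄`. -/
theorem swap (h : IsColumn q z u v) :
    IsColumn (fun x => -(starRingEnd ℂ) (q x)) (-z) v u := by
  constructor <;> intro x
  · exact (h.2 x).congr_deriv (by ring)
  · exact (h.1 x).congr_deriv (by simp)

theorem isSolution (h : IsColumn q z u v) : IsSolution q z (fun x => ![u x, v x]) := by
  intro x i
  fin_cases i
  · simpa [zsMatrix, sigma3, potentialMatrix, Matrix.mulVec, dotProduct, Fin.sum_univ_two]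
      using h.1 x
  · simpa [zsMatrix, sigma3, potentialMatrix, Matrix.mulVec, dotProduct, Fin.sum_univ_two,
      neg_add_eq_sub] using h.2 x

theorem mem_laxSpectrum (h : IsColumn q z u v) (h0 : u 0 ≠ 0 ∨ v 0 ≠ 0) {C : ℝ}
    (hC : ∀ x, ‖u x‖ ≤ C ∧ ‖v x‖ ≤ C) : z ∈ laxSpectrum q := by
  refine ⟨_, h.isSolution, ?_, C, fun x => ?_⟩
  · intro h1
    have e := congrFun h1 0
    have e0 := congrFun e 0
    have e1 := congrFun e 1
    simp at e0 e1
    tauto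
  · rw [pi_norm_le_iff_of_nonneg ((norm_nonneg _).trans (hC 0).1)]
    intro i
    fin_cases i
    · exact (hC x).1
    · exact (hC x).2

end IsColumn

/-! ### The monodromy matrix and points of the Lax spectrum. -/

namespace IsPrincipalSolution

variable {q : ℝ → ℂ} {Y : ℝ → ℂ → Matrix (Fin 2) (Fin 2) ℂ} {L : ℝ}

theorem isColumn (h : IsPrincipalSolution q Y) (z : ℂ) (k : Fin 2) :
    IsColumn q z (fun x => Y x z 0 k) (fun x => Y x z 1 k) := by
  constructor <;> intro x
  · simpa [zsMatrix, sigma3, potentialMatrix, Matrix.mul_apply, Fin.sum_univ_two]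
      using (h z).2 x 0 k
  · simpa [zsMatrix, sigma3, potentialMatrix, Matrix.mul_apply, Fin.sum_univ_two,
      neg_add_eq_sub] using (h z).2 x 1 k

theorem det_eq_one (h : IsPrincipalSolution q Y) (x : ℝ) (z : ℂ) :
    Y x z 0 0 * Y x z 1 1 - Y x z 0 1 * Y x z 1 0 = 1 := by
  have hd : ∀ x, HasDerivAt (fun x => Y x z 0 0 * Y x z 1 1 - Y x z 0 1 * Y x z 1 0) 0 x := by
    intro x
    exact ((((h.isColumn z 0).1 x).fun_mul ((h.isColumn z 1).2 x)).fun_sub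
      (((h.isColumn z 1).1 x).fun_mul ((h.isColumn z 0).2 x))).congr_deriv (by ring)
  have := is_const_of_deriv_eq_zero (fun x => (hd x).differentiableAt)
    (fun x => (hd x).deriv) x 0
  rw [this, (h z).1]
  simp

theorem norm_apply_le (h : IsPrincipalSolution q Y) (x : ℝ) (z : ℂ) (i k : Fin 2) :
    ‖Y x z i k‖ ≤ Real.exp (|z.im| * |x|) := by
  have := (h.isColumn z k).norm_le (by
    simp only [(h z).1]
    match k with
    | 0 => simp
    | 1 => simp) x
  fin_cases i
  · exact this.1
  · exact this.2

theorem apply_add (h : IsPrincipalSolution q Y) (hq : ∀ x, q (x + L) = q x) (x : ℝ) (z : ℂ) :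
    Y (x + L) z = Y x z * Y L z := by
  ext i k
  have := ((h.isColumn z k).translate hq).eq_of_initial
    (((h.isColumn z 0).mul_const (Y L z 0 k)).add ((h.isColumn z 1).mul_const (Y L z 1 k)))
    (by simp [(h z).1]) (by simp [(h z).1]) x
  fin_cases i
  · simpa [Matrix.mul_apply] using this.1
  · simpa [Matrix.mul_apply] using this.2

/-- For real z the energy is conserved, so every solution is bounded. -/
theorem mem_laxSpectrum_of_im_eq_zero (h : IsPrincipalSolution q Y) {z : ℂ} (hz : z.im = 0) :
    z ∈ laxSpectrum q := by
  refine (h.isColumn z 0).mem_laxSpectrum (C := 1) (by simp [(h z).1]) fun x => ?_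
  have h0 := h.norm_apply_le x z 0 0
  have h1 := h.norm_apply_le x z 1 0
  simp only [hz, abs_zero, zero_mul, Real.exp_zero] at h0 h1
  exact ⟨h0, h1⟩

/-- If Δ = σ = ±1, then σ is an eigenvalue of the monodromy matrix, since its determinant is 1. An
eigenvector starts a periodic or antiperiodic solution, which is bounded by its values on one
period. -/
theorem mem_laxSpectrum_of_discriminant (h : IsPrincipalSolution q Y) (hL : 0 < L)
    (hq : ∀ x, q (x + L) = q x) {z : ℂ} (hz : discriminant L Y z ^ 2 - 1 = 0) :
    z ∈ laxSpectrum q := by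
  obtain ⟨σ, hσ, hΔ⟩ : ∃ σ : ℂ, σ ^ 2 = 1 ∧ discriminant L Y z = σ :=
    ⟨_, by linear_combination hz, rfl⟩
  have hdet := h.det_eq_one L z
  have htr : Y L z 0 0 + Y L z 1 1 = 2 * σ := by
    rw [← hΔ]; simp [discriminant, Matrix.trace_fin_two]; ring
  obtain ⟨c, hc, hMc⟩ : ∃ c : Fin 2 → ℂ, c ≠ 0 ∧ (Y L z - σ • 1).mulVec c = 0 := by
    rw [Matrix.exists_mulVec_eq_zero_iff, Matrix.det_fin_two]
    simp
    linear_combination hdet - σ * htr - hσ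
  have e0 : Y L z 0 0 * c 0 + Y L z 0 1 * c 1 = σ * c 0 := by
    have := congrFun hMc 0
    simp [Matrix.mulVec, dotProduct, Fin.sum_univ_two] at this
    linear_combination this
  have e1 : Y L z 1 0 * c 0 + Y L z 1 1 * c 1 = σ * c 1 := by
    have := congrFun hMc 1
    simp [Matrix.mulVec, dotProduct, Fin.sum_univ_two] at this
    linear_combination this
  have hcol := ((h.isColumn z 0).mul_const (c 0)).add ((h.isColumn z 1).mul_const (c 1))
  have hσn : ‖σ‖ = 1 := by
    have := congrArg norm hσ
    rw [norm_pow, norm_one] at this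
    exact (pow_eq_one_iff_of_nonneg (norm_nonneg _) two_ne_zero).1 this
  have bound : ∀ w : ℝ → ℂ, Continuous w → (∀ x, w (x + L) = σ * w x) → ∃ C, ∀ x, ‖w x‖ ≤ C := by
    intro w hw hper
    have hp : Function.Periodic (fun x => ‖w x‖) L := fun x => by simp [hper, hσn]
    obtain ⟨C, hC⟩ := (isCompact_Icc (a := (0 : ℝ)) (b := 0 + L)).exists_bound_of_continuousOn
      hw.continuousOn
    refine ⟨C, fun x => ?_⟩
    obtain ⟨y, hy, hxy⟩ := hp.exists_mem_Ico hL x 0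
    rw [hxy]
    exact hC y (Set.Ico_subset_Icc_self hy)
  obtain ⟨C₁, h1⟩ := bound (fun x => Y x z 0 0 * c 0 + Y x z 0 1 * c 1) (continuous_iff_continuousAt.2 fun x => (hcol.1 x).continuousAt)
    (fun x => by
      simp only [h.apply_add hq, Matrix.mul_apply, Fin.sum_univ_two]
      linear_combination Y x z 0 0 * e0 + Y x z 0 1 * e1)
  obtain ⟨C₂, h2⟩ := bound (fun x => Y x z 1 0 * c 0 + Y x z 1 1 * c 1) (continuous_iff_continuousAt.2 fun x => (hcol.2 x).continuousAt)
    (fun x => by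
      simp only [h.apply_add hq, Matrix.mul_apply, Fin.sum_univ_two]
      linear_combination Y x z 1 0 * e0 + Y x z 1 1 * e1)
  refine hcol.mem_laxSpectrum (C := max C₁ C₂) ?_
    fun x => ⟨(h1 x).trans (le_max_left _ _), (h2 x).trans (le_max_right _ _)⟩
  by_contra! hh
  simp only [(h z).1] at hh
  apply hc
  ext i
  fin_cases i
  · simpa using hh.1
  · simpa using hh.2

/-- For a real even potential the off-diagonal entries of the monodromy matrix are opposite. -/
theorem offDiag_add_eq_zero (h : IsPrincipalSolution q Y) (hq : ∀ x, q (x + L) = q x)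
    (hreal : ∀ x, (q x).im = 0) (heven : ∀ x, q (-x) = q x) (z : ℂ) :
    Y L z 0 1 + Y L z 1 0 = 0 := by
  have hqr : (fun x => (starRingEnd ℂ) (q (-x))) = q := by
    ext x; rw [heven, Complex.conj_eq_iff_im.2 (hreal x)]
  have hr : ∀ k, IsColumn q z (fun x => Y (-x) z 1 k) (fun x => Y (-x) z 0 k) := fun k => by
    have := (h.isColumn z k).reflect
    rwa [hqr] at this
  have h0 := (hr 0).eq_of_initial (h.isColumn z 1) (by simp [(h z).1]) (by simp [(h z).1]) L
  have h1 := (hr 1).eq_of_initial (h.isColumn z 0) (by simp [(h z).1]) (by simp [(h z).1]) L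
  -- By reflection, Y(-L) is Y(L) with both its rows and its columns exchanged. Adding the diagonal
  -- entries of Y(-L) Y(L) = 1 and subtracting twice the determinant leaves the square of the sum of
  -- the off-diagonal entries.
  have hI : Y (-L) z * Y L z = 1 := by rw [← h.apply_add hq, neg_add_cancel, (h z).1]
  have a00 := congrFun (congrFun hI 0) 0
  have a11 := congrFun (congrFun hI 1) 1
  simp only [Matrix.mul_apply, Fin.sum_univ_two, h0.1, h0.2, h1.1, h1.2, Matrix.one_apply_eq]
    at a00 a11
  have hdet := h.det_eq_one L z
  rw [← sq_eq_zero_iff]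
  linear_combination a00 + a11 - 2 * hdet

end IsPrincipalSolution

/-! ### Asymptotics of solutions for large spectral parameter. -/

namespace IsColumn

variable {q q' : ℝ → ℂ} {z : ℂ} {u v : ℝ → ℂ} {L : ℝ}

/-- One integration by parts: e^{izx} u has derivative e^{izx} q v, and the oscillation of e^{izx} v
gains a factor 1/z at the cost of one derivative of q. -/
theorem norm_sub_exp_le (h : IsColumn q z u v) (hL : 0 ≤ L) (hz : z ≠ 0) {K K' : ℝ}
    (hK : ∀ x ∈ Set.Icc 0 L, ‖q x‖ ≤ K) (hK' : ∀ x ∈ Set.Icc 0 L, ‖q' x‖ ≤ K')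
    (hq : ∀ x ∈ Set.Icc 0 L, HasDerivWithinAt q (q' x) (Set.Icc 0 L) x)
    (h0 : ‖u 0‖ ^ 2 + ‖v 0‖ ^ 2 ≤ 1) :
    ‖u L - exp (-(I * z * L)) * u 0‖ ≤
      ((K' + K ^ 2) * L + K) * Real.exp (|z.im| * L) / ‖z‖ := by
  have hzn : 0 < ‖z‖ := norm_pos_iff.2 hz
  have h0m : (0 : ℝ) ∈ Set.Icc 0 L := ⟨le_rfl, hL⟩
  have hLm : L ∈ Set.Icc 0 L := ⟨hL, le_rfl⟩
  have hK0 : 0 ≤ K := (norm_nonneg _).trans (hK 0 h0m)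
  have hK0' : 0 ≤ K' := (norm_nonneg _).trans (hK' 0 h0m)
  have hexp : ∀ x : ℝ, ‖exp (I * z * x)‖ = Real.exp (-(z.im * x)) := fun x => by
    rw [Complex.norm_exp]; simp
  -- The corrector i q v/(2z) is chosen so that its derivative cancels the term q v, leaving a
  -- derivative of F that carries the factor 1/z.
  set F : ℝ → ℂ := fun x => exp (I * z * x) * (u x + I * q x / (2 * z) * v x) with hF
  have hFd : ∀ x ∈ Set.Icc 0 L, HasDerivWithinAt F
      (exp (I * z * x) * (I / (2 * z) * (q' x * v x - (starRingEnd ℂ) (q x) * q x * u x)))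
      (Set.Icc 0 L) x := by
    intro x hx
    have he : HasDerivAt (fun x : ℝ => exp (I * z * x)) (exp (I * z * x) * (I * z)) x := by
      have h1 : HasDerivAt (fun x : ℝ => I * z * (x : ℂ)) (I * z) x := by
        simpa using (Complex.ofRealCLM.hasDerivAt (x := x)).const_mul (I * z)
      exact h1.cexp
    refine (he.hasDerivWithinAt.mul ((h.1 x).hasDerivWithinAt.add
      ((((hq x hx).const_mul I).div_const (2 * z)).mul
        (h.2 x).hasDerivWithinAt))).congr_deriv ?_
    have hI : I ^ 2 = -1 := I_sq
    simp only [Pi.add_apply, Pi.mul_apply]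
    field_simp
    linear_combination (2 * z * q x * v x) * hI
  have hbound : ∀ x ∈ Set.Ico 0 L,
      ‖exp (I * z * x) * (I / (2 * z) * (q' x * v x - (starRingEnd ℂ) (q x) * q x * u x))‖ ≤
        Real.exp ((|z.im| - z.im) * L) * ((K' + K ^ 2) / (2 * ‖z‖)) := by
    intro x hx
    have hx' : x ∈ Set.Icc 0 L := Set.Ico_subset_Icc_self hx
    obtain ⟨hu, hv⟩ := h.norm_le h0 x
    rw [abs_of_nonneg hx.1] at hu hv
    have hin : ‖q' x * v x - (starRingEnd ℂ) (q x) * q x * u x‖ ≤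
        (K' + K ^ 2) * Real.exp (|z.im| * x) := by
      refine (norm_sub_le _ _).trans ?_
      rw [norm_mul, norm_mul, norm_mul, RCLike.norm_conj, add_mul, sq]
      have := hK x hx'
      have := hK' x hx'
      gcongr
    rw [norm_mul, hexp, norm_mul, norm_div, norm_I, norm_mul, RCLike.norm_ofNat]
    calc Real.exp (-(z.im * x)) *
          (1 / (2 * ‖z‖) * ‖q' x * v x - (starRingEnd ℂ) (q x) * q x * u x‖)
        ≤ Real.exp (-(z.im * x)) * (1 / (2 * ‖z‖) * ((K' + K ^ 2) * Real.exp (|z.im| * x))) := by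
          gcongr
      _ = Real.exp ((|z.im| - z.im) * x) * ((K' + K ^ 2) / (2 * ‖z‖)) := by
          rw [show (|z.im| - z.im) * x = -(z.im * x) + |z.im| * x by ring, Real.exp_add]; ring
      _ ≤ _ := by
          have := sub_nonneg.2 (le_abs_self z.im)
          have := hx.2.le
          gcongr
  have hmv := norm_image_sub_le_of_norm_deriv_le_segment' hFd hbound L hLm
  have e : exp (-(I * z * L)) * exp (I * z * L) = 1 := by rw [← Complex.exp_add]; simp
  have hexpL : ‖exp (-(I * z * L))‖ = Real.exp (z.im * L) := by
    rw [Complex.norm_exp]; simp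
  have hE : Real.exp (z.im * L) ≤ Real.exp (|z.im| * L) := by
    have := le_abs_self z.im
    gcongr
  have hvL := (h.norm_le h0 L).2
  rw [abs_of_nonneg hL] at hvL
  have hv0 := (h.norm_le h0 0).2
  simp only [abs_zero, mul_zero, Real.exp_zero] at hv0
  have key : u L - exp (-(I * z * L)) * u 0 = exp (-(I * z * L)) * (F L - F 0) -
      I * q L / (2 * z) * v L + exp (-(I * z * L)) * (I * q 0 / (2 * z) * v 0) := by
    have hF0 : F 0 = u 0 + I * q 0 / (2 * z) * v 0 := by simp [hF]
    rw [hF0]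
    simp only [hF]
    linear_combination (-(u L + I * q L / (2 * z) * v L)) * e
  rw [key]
  refine (norm_add_le _ _).trans ((add_le_add_left (norm_sub_le _ _) _).trans ?_)
  have n1 : ‖exp (-(I * z * L)) * (F L - F 0)‖ ≤
      Real.exp (|z.im| * L) * ((K' + K ^ 2) / (2 * ‖z‖) * L) := by
    rw [norm_mul, hexpL]
    calc _ ≤ Real.exp (z.im * L) *
        (Real.exp ((|z.im| - z.im) * L) * ((K' + K ^ 2) / (2 * ‖z‖)) * (L - 0)) := by gcongr
      _ = _ := by
        rw [show |z.im| * L = z.im * L + (|z.im| - z.im) * L by ring, Real.exp_add]; ring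
  have n2 : ‖I * q L / (2 * z) * v L‖ ≤ K / (2 * ‖z‖) * Real.exp (|z.im| * L) := by
    rw [norm_mul, norm_div, norm_mul, norm_I, norm_mul, RCLike.norm_ofNat, one_mul]
    have := hK L hLm
    gcongr
  have n3 : ‖exp (-(I * z * L)) * (I * q 0 / (2 * z) * v 0)‖ ≤
      Real.exp (|z.im| * L) * (K / (2 * ‖z‖) * 1) := by
    rw [norm_mul, hexpL, norm_mul, norm_div, norm_mul, norm_I, norm_mul, RCLike.norm_ofNat,
      one_mul]
    have := hK 0 h0m
    gcongr
  have n4 : 0 ≤ Real.exp (|z.im| * L) * ((K' + K ^ 2) / (2 * ‖z‖) * L) := by positivity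
  calc _ ≤ Real.exp (|z.im| * L) * ((K' + K ^ 2) / (2 * ‖z‖) * L) +
        K / (2 * ‖z‖) * Real.exp (|z.im| * L) +
        Real.exp (|z.im| * L) * (K / (2 * ‖z‖) * 1) := by gcongr
    _ ≤ 2 * (Real.exp (|z.im| * L) * ((K' + K ^ 2) / (2 * ‖z‖) * L)) +
        K / (2 * ‖z‖) * Real.exp (|z.im| * L) +
        Real.exp (|z.im| * L) * (K / (2 * ‖z‖) * 1) := by linarith
    _ = _ := by field_simp; ring

end IsColumn

namespace IsPrincipalSolution

variable {q : ℝ → ℂ} {Y : ℝ → ℂ → Matrix (Fin 2) (Fin 2) ℂ} {L : ℝ}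

theorem exists_asymptotics (h : IsPrincipalSolution q Y) (hL : 0 < L)
    (hq : ContDiffOn ℝ 2 q (Set.Icc 0 L)) :
    ∃ C : ℝ, 0 ≤ C ∧ ∀ z : ℂ, z ≠ 0 →
      ‖Y L z 0 0 - exp (-(I * z * L))‖ ≤ C * Real.exp (|z.im| * L) / ‖z‖ ∧
      ‖Y L z 0 1‖ ≤ C * Real.exp (|z.im| * L) / ‖z‖ ∧
      ‖Y L z 1 0‖ ≤ C * Real.exp (|z.im| * L) / ‖z‖ ∧
      ‖Y L z 1 1 - exp (I * z * L)‖ ≤ C * Real.exp (|z.im| * L) / ‖z‖ := by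
  obtain ⟨K, hK⟩ := isCompact_Icc.exists_bound_of_continuousOn hq.continuousOn
  obtain ⟨K', hK'⟩ := isCompact_Icc.exists_bound_of_continuousOn
    (hq.continuousOn_derivWithin (uniqueDiffOn_Icc hL) (by norm_num))
  have hd : ∀ x ∈ Set.Icc 0 L,
      HasDerivWithinAt q (derivWithin q (Set.Icc 0 L) x) (Set.Icc 0 L) x := fun x hx =>
    (hq.differentiableOn (by norm_num) x hx).hasDerivWithinAt
  have h0m : (0 : ℝ) ∈ Set.Icc 0 L := ⟨le_rfl, hL.le⟩
  have hK0 : 0 ≤ K := (norm_nonneg _).trans (hK 0 h0m)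
  have hK0' : 0 ≤ K' := (norm_nonneg _).trans (hK' 0 h0m)
  refine ⟨(K' + K ^ 2) * L + K, by positivity, fun z hz => ?_⟩
  have hu : ∀ k, ‖Y 0 z 0 k‖ ^ 2 + ‖Y 0 z 1 k‖ ^ 2 ≤ 1 := fun k => by
    simp only [(h z).1]
    match k with
    | 0 => simp
    | 1 => simp
  have a := fun k => (h.isColumn z k).norm_sub_exp_le hL.le hz hK hK' hd (hu k)
  -- The second row comes from the swapped system, whose spectral parameter is -z and whose
  -- potential satisfies the same bounds.
  have b := fun k => (h.isColumn z k).swap.norm_sub_exp_le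
    (q' := fun x => -(starRingEnd ℂ) (derivWithin q (Set.Icc 0 L) x)) hL.le (neg_ne_zero.2 hz)
    (by simpa using hK) (by simpa using hK')
    (fun x hx => by
      exact (Complex.conjCLE.toContinuousLinearMap.hasFDerivAt.comp_hasDerivWithinAt x
        (hd x hx)).fun_neg)
    ((add_comm _ _).trans_le (hu k))
  have a0 := a 0
  have a1 := a 1
  have b0 := b 0
  have b1 := b 1
  simp only [(h z).1, norm_neg, neg_im, abs_neg, mul_neg, neg_mul, neg_neg] at a0 a1 b0 b1
  refine ⟨by simpa using a0, by simpa using a1, by simpa using b0, by simpa using b1⟩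

/-! ### Analytic dependence on the spectral parameter. -/

/-- The potential terms cancel between the two parameters; only the factor w - z survives. Comparing
w with z thus needs no differentiation under the differential equation. -/
theorem hasDerivAt_wronskian (h : IsPrincipalSolution q Y) (z w : ℂ) (j k : Fin 2) (x : ℝ) :
    HasDerivAt (fun x => Y x z 0 j * Y x w 1 k - Y x z 1 j * Y x w 0 k)
      (I * (w - z) * (Y x z 0 j * Y x w 1 k + Y x z 1 j * Y x w 0 k)) x :=
  ((((h.isColumn z j).1 x).fun_mul ((h.isColumn w k).2 x)).fun_sub
    (((h.isColumn z j).2 x).fun_mul ((h.isColumn w k).1 x))).congr_deriv (by ring)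

theorem continuous_apply (h : IsPrincipalSolution q Y) (z : ℂ) (i k : Fin 2) :
    Continuous fun x => Y x z i k :=
  continuous_iff_continuousAt.2 fun x => ((h z).2 x i k).continuousAt

/-- Cramer's rule: the column at w is expanded in the basis of columns at z, with Wronskians as
coefficients. With z fixed these are the only quantities depending on w, so regularity in w reduces
to theirs. -/
theorem fst_eq_wronskian (h : IsPrincipalSolution q Y) (z w : ℂ) (k : Fin 2) (x : ℝ) :
    Y x w 0 k = Y x z 0 1 * (Y x z 0 0 * Y x w 1 k - Y x z 1 0 * Y x w 0 k) -
      Y x z 0 0 * (Y x z 0 1 * Y x w 1 k - Y x z 1 1 * Y x w 0 k) := by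
  linear_combination (-(Y x w 0 k)) * h.det_eq_one x z

theorem snd_eq_wronskian (h : IsPrincipalSolution q Y) (z w : ℂ) (k : Fin 2) (x : ℝ) :
    Y x w 1 k = Y x z 1 1 * (Y x z 0 0 * Y x w 1 k - Y x z 1 0 * Y x w 0 k) -
      Y x z 1 0 * (Y x z 0 1 * Y x w 1 k - Y x z 1 1 * Y x w 0 k) := by
  linear_combination (-(Y x w 1 k)) * h.det_eq_one x z

theorem exists_lipschitz (h : IsPrincipalSolution q Y) (hL : 0 ≤ L) (z : ℂ) :
    ∃ C : ℝ, 0 ≤ C ∧ ∀ w, ‖w - z‖ ≤ 1 → ∀ x ∈ Set.Icc 0 L, ∀ i k,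
      ‖Y x z i k‖ ≤ C ∧ ‖Y x w i k - Y x z i k‖ ≤ C * ‖w - z‖ := by
  set E := Real.exp ((|z.im| + 1) * L) with hE
  have hE1 : 1 ≤ E := Real.one_le_exp (by positivity)
  have bound : ∀ w, ‖w - z‖ ≤ 1 → ∀ x ∈ Set.Icc 0 L, ∀ i k, ‖Y x w i k‖ ≤ E := by
    intro w hw x hx i k
    refine (h.norm_apply_le x w i k).trans ?_
    rw [abs_of_nonneg hx.1, hE]
    have h1 : |w.im| ≤ |z.im| + 1 := by
      have h2 := (Complex.abs_im_le_norm (w - z)).trans hw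
      have h3 := abs_sub_abs_le_abs_sub w.im z.im
      simp only [sub_im] at h2
      linarith
    have := hx.2
    have := hx.1
    gcongr
  have boundz := bound z (by simp)
  refine ⟨E + 4 * E ^ 3 * L, by positivity, fun w hw x hx i k => ⟨?_, ?_⟩⟩
  · have : 0 ≤ 4 * E ^ 3 * L := by positivity
    linarith [boundz x hx i k]
  have wr : ∀ j, ‖(Y x z 0 j * Y x w 1 k - Y x z 1 j * Y x w 0 k) -
      (Y x z 0 j * Y x z 1 k - Y x z 1 j * Y x z 0 k)‖ ≤ 2 * E ^ 2 * ‖w - z‖ * L := by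
    intro j
    have h1 := norm_image_sub_le_of_norm_deriv_le_segment' (C := 2 * E ^ 2 * ‖w - z‖)
      (fun y _ => (h.hasDerivAt_wronskian z w j k y).hasDerivWithinAt (s := Set.Icc 0 L))
      (fun y hy => by
        have hy' := Set.Ico_subset_Icc_self hy
        rw [norm_mul, norm_mul, norm_I, one_mul, mul_comm]
        gcongr
        refine (norm_add_le _ _).trans ?_
        rw [norm_mul, norm_mul]
        have e1 := boundz y hy' 0 j
        have e2 := boundz y hy' 1 j
        have e3 := bound w hw y hy' 0 k
        have e4 := bound w hw y hy' 1 k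
        calc _ ≤ E * E + E * E := by gcongr
          _ = _ := by ring) x hx
    have h2 := norm_image_sub_le_of_norm_deriv_le_segment' (C := 0)
      (fun y _ => (h.hasDerivAt_wronskian z z j k y).hasDerivWithinAt (s := Set.Icc 0 L))
      (fun y hy => by simp) x hx
    simp only [zero_mul, norm_le_zero_iff] at h2
    rw [sub_eq_zero.1 h2]
    simp only [(h z).1, (h w).1] at h1 ⊢
    refine h1.trans ?_
    have := hx.2
    gcongr
    linarith
  have combine : ∀ c d α β γ δ : ℂ, ‖c‖ ≤ E → ‖d‖ ≤ E →
      ‖α - γ‖ ≤ 2 * E ^ 2 * ‖w - z‖ * L → ‖β - δ‖ ≤ 2 * E ^ 2 * ‖w - z‖ * L →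
      ‖(c * α - d * β) - (c * γ - d * δ)‖ ≤ (E + 4 * E ^ 3 * L) * ‖w - z‖ := by
    intro c d α β γ δ hc hd h1 h2
    rw [show (c * α - d * β) - (c * γ - d * δ) = c * (α - γ) - d * (β - δ) by ring]
    refine (norm_sub_le _ _).trans ?_
    rw [norm_mul, norm_mul]
    have h5 : 0 ≤ E * ‖w - z‖ := by positivity
    calc _ ≤ E * (2 * E ^ 2 * ‖w - z‖ * L) + E * (2 * E ^ 2 * ‖w - z‖ * L) := by gcongr
      _ ≤ _ := by linarith
  match i with
  | 0 =>
    rw [h.fst_eq_wronskian z w k x, h.fst_eq_wronskian z z k x]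
    exact combine _ _ _ _ _ _ (boundz x hx _ _) (boundz x hx _ _) (wr 0) (wr 1)
  | 1 =>
    rw [h.snd_eq_wronskian z w k x, h.snd_eq_wronskian z z k x]
    exact combine _ _ _ _ _ _ (boundz x hx _ _) (boundz x hx _ _) (wr 0) (wr 1)

/-- Integrating the Wronskian identity suggests the derivative i J(L), with J the integral of the
right-hand side at w = z. The Lipschitz bound makes the remainder O(|w - z|²). -/
theorem differentiableAt_wronskian (h : IsPrincipalSolution q Y) (hL : 0 ≤ L) (z : ℂ)
    (j k : Fin 2) :
    DifferentiableAt ℂ (fun w => Y L z 0 j * Y L w 1 k - Y L z 1 j * Y L w 0 k) z := by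
  obtain ⟨C, hC, hlip⟩ := h.exists_lipschitz hL z
  set J : ℝ → ℂ := fun x => ∫ y in (0 : ℝ)..x, (Y y z 0 j * Y y z 1 k + Y y z 1 j * Y y z 0 k)
    with hJ
  have hcont : Continuous fun y => Y y z 0 j * Y y z 1 k + Y y z 1 j * Y y z 0 k := by
    have := h.continuous_apply z
    fun_prop
  have hJd : ∀ x, HasDerivAt J (Y x z 0 j * Y x z 1 k + Y x z 1 j * Y x z 0 k) x := fun x =>
    intervalIntegral.integral_hasDerivAt_right (hcont.intervalIntegrable _ _)
      (hcont.stronglyMeasurableAtFilter _ _) hcont.continuousAt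
  have hLm : L ∈ Set.Icc 0 L := ⟨hL, le_rfl⟩
  suffices HasDerivAt (fun w => Y L z 0 j * Y L w 1 k - Y L z 1 j * Y L w 0 k) (I * J L) z from
    this.differentiableAt
  rw [hasDerivAt_iff_isLittleO]
  refine Asymptotics.IsBigO.trans_isLittleO (g := fun w => ‖w - z‖ ^ 2) ?_
    (Asymptotics.isLittleO_pow_sub_sub z one_lt_two)
  refine Asymptotics.IsBigO.of_bound (2 * C ^ 2 * L) ?_
  filter_upwards [Metric.closedBall_mem_nhds z one_pos] with w hw
  rw [mem_closedBall_iff_norm] at hw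
  have h1 := norm_image_sub_le_of_norm_deriv_le_segment' (C := 2 * C ^ 2 * ‖w - z‖ ^ 2)
    (fun y _ => ((h.hasDerivAt_wronskian z w j k y).fun_sub
      ((hJd y).const_mul (I * (w - z)))).hasDerivWithinAt (s := Set.Icc 0 L))
    (fun y hy => by
      have hy' := Set.Ico_subset_Icc_self hy
      rw [← mul_sub, norm_mul, norm_mul, norm_I, one_mul]
      have e : (Y y z 0 j * Y y w 1 k + Y y z 1 j * Y y w 0 k) -
        (Y y z 0 j * Y y z 1 k + Y y z 1 j * Y y z 0 k) =
        Y y z 0 j * (Y y w 1 k - Y y z 1 k) + Y y z 1 j * (Y y w 0 k - Y y z 0 k) := by ring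
      have n : ‖(Y y z 0 j * Y y w 1 k + Y y z 1 j * Y y w 0 k) -
        (Y y z 0 j * Y y z 1 k + Y y z 1 j * Y y z 0 k)‖ ≤ 2 * C ^ 2 * ‖w - z‖ := by
        rw [e]
        refine (norm_add_le _ _).trans ?_
        rw [norm_mul, norm_mul]
        have e1 := (hlip w hw y hy' 0 j).1
        have e2 := (hlip w hw y hy' 1 j).1
        have e3 := (hlip w hw y hy' 0 k).2
        have e4 := (hlip w hw y hy' 1 k).2
        calc _ ≤ C * (C * ‖w - z‖) + C * (C * ‖w - z‖) := by gcongr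
          _ = _ := by ring
      calc _ ≤ ‖w - z‖ * (2 * C ^ 2 * ‖w - z‖) := by gcongr
        _ = _ := by ring) L hLm
  have h2 := norm_image_sub_le_of_norm_deriv_le_segment' (C := 0)
    (fun y _ => (h.hasDerivAt_wronskian z z j k y).hasDerivWithinAt (s := Set.Icc 0 L))
    (fun y hy => by simp) L hLm
  simp only [zero_mul, norm_le_zero_iff] at h2
  have hJ0 : J 0 = 0 := by simp [hJ]
  have hnn : ‖(‖w - z‖ ^ 2 : ℝ)‖ = ‖w - z‖ ^ 2 := by simp
  rw [hnn, sub_eq_zero.1 h2]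
  simp only [hJ0, (h z).1, (h w).1, mul_zero, sub_zero] at h1 ⊢
  calc _ = _ := by
        congr 1
        simp only [smul_eq_mul]
        ring
    _ ≤ _ := h1
    _ = _ := by ring

/-- The monodromy matrix is an entire function of the spectral parameter. -/
theorem differentiable_apply (h : IsPrincipalSolution q Y) (hL : 0 ≤ L) (i k : Fin 2) :
    Differentiable ℂ fun z => Y L z i k := by
  intro z
  have w0 := h.differentiableAt_wronskian hL z 0 k
  have w1 := h.differentiableAt_wronskian hL z 1 k
  match i with
  | 0 =>
    exact ((w0.const_mul (Y L z 0 1)).fun_sub (w1.const_mul (Y L z 0 0))).congr_of_eventuallyEq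
      (Eventually.of_forall fun w => h.fst_eq_wronskian z w k L)
  | 1 =>
    exact ((w0.const_mul (Y L z 1 1)).fun_sub (w1.const_mul (Y L z 1 0))).congr_of_eventuallyEq
      (Eventually.of_forall fun w => h.snd_eq_wronskian z w k L)

end IsPrincipalSolution

/-! ### Comparison of ỹ₁₂ and Δ² - 1 with the sine function. -/

theorem modMonodromy_eq (L : ℝ) (Y : ℝ → ℂ → Matrix (Fin 2) (Fin 2) ℂ) (z : ℂ) :
    modMonodromy L Y z = (1 / 2 : ℂ) • !![Y L z 0 0 + Y L z 0 1 + Y L z 1 0 + Y L z 1 1,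
      I * (Y L z 0 0 - Y L z 0 1 + Y L z 1 0 - Y L z 1 1);
      I * (Y L z 1 0 + Y L z 1 1 - Y L z 0 0 - Y L z 0 1),
      Y L z 0 0 - Y L z 0 1 - Y L z 1 0 + Y L z 1 1] := by
  have h2 : ((1 / Real.sqrt 2 : ℝ) : ℂ) * ((1 / Real.sqrt 2 : ℝ) : ℂ) = 1 / 2 := by
    rw [← Complex.ofReal_mul, div_mul_div_comm, Real.mul_self_sqrt (by norm_num)]
    norm_num
  have hinv : U⁻¹ = ((1 / Real.sqrt 2 : ℝ) : ℂ) • !![1, I; 1, -I] := by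
    apply Matrix.inv_eq_right_inv
    rw [U, Matrix.smul_mul, Matrix.mul_smul, smul_smul, h2]
    ext i j
    fin_cases i <;> fin_cases j <;> simp <;> norm_num
  rw [modMonodromy, hinv, U, Matrix.smul_mul, Matrix.mul_smul, Matrix.smul_mul, smul_smul, h2]
  congr 1
  generalize Y L z = M
  obtain ⟨a, b, c, d, rfl⟩ : ∃ a b c d, M = !![a, b; c, d] := ⟨_, _, _, _, Matrix.eta_fin_two M⟩
  have hI : I ^ 2 = -1 := I_sq
  ext i j
  fin_cases i <;> fin_cases j <;> simp
  · ring
  · ring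
  · ring
  · linear_combination (b + c - a - d) * hI

namespace FloquetData

variable {L : ℝ} (D : FloquetData L)

theorem y12_eq (z : ℂ) :
    D.y12 z = I / 2 * (D.Y L z 0 0 - D.Y L z 0 1 + D.Y L z 1 0 - D.Y L z 1 1) := by
  simp [y12, modMonodromy_eq]; ring

theorem y22_eq (z : ℂ) :
    D.y22 z = (D.Y L z 0 0 - D.Y L z 0 1 - D.Y L z 1 0 + D.Y L z 1 1) / 2 := by
  simp [y22, modMonodromy_eq]; ring

theorem discriminant_eq (z : ℂ) :
    discriminant L D.Y z = (D.Y L z 0 0 + D.Y L z 1 1) / 2 := by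
  simp [discriminant, Matrix.trace_fin_two]

theorem differentiable_y12 (hL : 0 < L) : Differentiable ℂ D.y12 := by
  have := D.principal.differentiable_apply hL.le
  rw [funext D.y12_eq]
  fun_prop

theorem differentiable_discriminant (hL : 0 < L) : Differentiable ℂ (discriminant L D.Y) := by
  have := D.principal.differentiable_apply hL.le
  rw [funext D.discriminant_eq]
  fun_prop

theorem exists_y12_asymptotics (hL : 0 < L) : ∃ C : ℝ, ∀ z : ℂ, z ≠ 0 →
    ‖D.y12 z - sin (z * L)‖ ≤ C * Real.exp (|z.im| * L) / ‖z‖ := by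
  obtain ⟨C, hC, h⟩ := D.principal.exists_asymptotics hL D.smooth
  refine ⟨2 * C, fun z hz => ?_⟩
  obtain ⟨h1, h2, h3, h4⟩ := h z hz
  have e : D.y12 z - sin (z * L) = I / 2 * ((D.Y L z 0 0 - exp (-(I * z * L))) - D.Y L z 0 1 +
      D.Y L z 1 0 - (D.Y L z 1 1 - exp (I * z * L))) := by
    rw [y12_eq, Complex.sin, show -(z * L) * I = -(I * z * L) by ring,
      show (z * L) * I = I * z * L by ring]
    ring
  rw [e, norm_mul, norm_div, norm_I, RCLike.norm_ofNat]
  have := norm_sub_le ((D.Y L z 0 0 - exp (-(I * z * L))) - D.Y L z 0 1 +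
      D.Y L z 1 0) (D.Y L z 1 1 - exp (I * z * L))
  have := norm_add_le ((D.Y L z 0 0 - exp (-(I * z * L))) - D.Y L z 0 1) (D.Y L z 1 0)
  have := norm_sub_le (D.Y L z 0 0 - exp (-(I * z * L))) (D.Y L z 0 1)
  rw [show 2 * C * Real.exp (|z.im| * L) / ‖z‖ = 2 * (C * Real.exp (|z.im| * L) / ‖z‖) by ring]
  linarith

theorem exists_discriminant_asymptotics (hL : 0 < L) : ∃ C : ℝ, ∀ z : ℂ, z ≠ 0 →
    ‖(discriminant L D.Y z ^ 2 - 1) + sin (z * L) ^ 2‖ ≤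
      C * Real.exp (|z.im| * L) ^ 2 / ‖z‖ := by
  obtain ⟨C, hC, h⟩ := D.principal.exists_asymptotics hL D.smooth
  refine ⟨2 * C, fun z hz => ?_⟩
  obtain ⟨h1, -, -, h4⟩ := h z hz
  set E := Real.exp (|z.im| * L) with hE
  have hcos : cos (z * L) = (exp (I * z * L) + exp (-(I * z * L))) / 2 := by
    rw [Complex.cos, show -(z * L) * I = -(I * z * L) by ring,
      show (z * L) * I = I * z * L by ring]
  -- The left side is Δ² - cos²; in the factorization only the difference Δ - cos is small, while
  -- the sum is merely bounded by the exponential.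
  have e : (discriminant L D.Y z ^ 2 - 1) + sin (z * L) ^ 2 =
      (discriminant L D.Y z - cos (z * L)) * (discriminant L D.Y z + cos (z * L)) := by
    linear_combination Complex.sin_sq_add_cos_sq (z * L)
  have n1 : ‖discriminant L D.Y z - cos (z * L)‖ ≤ C * E / ‖z‖ := by
    rw [hcos, discriminant_eq, ← sub_div, norm_div, RCLike.norm_ofNat,
      show D.Y L z 0 0 + D.Y L z 1 1 - (exp (I * z * L) + exp (-(I * z * L))) =
        (D.Y L z 0 0 - exp (-(I * z * L))) + (D.Y L z 1 1 - exp (I * z * L)) by ring]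
    have := norm_add_le (D.Y L z 0 0 - exp (-(I * z * L))) (D.Y L z 1 1 - exp (I * z * L))
    linarith
  have b1 : ‖exp (I * z * L)‖ ≤ E := by
    rw [Complex.norm_exp, hE, Real.exp_le_exp]
    simp
    nlinarith [neg_abs_le z.im]
  have b2 : ‖exp (-(I * z * L))‖ ≤ E := by
    rw [Complex.norm_exp, hE, Real.exp_le_exp]
    simp
    nlinarith [le_abs_self z.im]
  have n2 : ‖discriminant L D.Y z + cos (z * L)‖ ≤ 2 * E := by
    have b3 := D.principal.norm_apply_le L z 0 0
    have b4 := D.principal.norm_apply_le L z 1 1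
    rw [abs_of_pos hL, ← hE] at b3 b4
    refine (norm_add_le _ _).trans ?_
    rw [hcos, discriminant_eq, norm_div, norm_div, RCLike.norm_ofNat]
    have := norm_add_le (exp (I * z * L)) (exp (-(I * z * L)))
    have := norm_add_le (D.Y L z 0 0) (D.Y L z 1 1)
    linarith
  rw [e, norm_mul]
  calc _ ≤ C * E / ‖z‖ * (2 * E) := by gcongr
    _ = _ := by ring

end FloquetData

/-! ### Estimates for the sine product on large squares. -/

/-- The `j`-th zero `jπ/L` of `sin (z L)`. -/
def sineZero (L : ℝ) (j : ℤ) : ℂ := ((Real.pi * j / L : ℝ) : ℂ)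

theorem piNorm_ne_zero {L : ℝ} (hL : L ≠ 0) (j : ℤ) : piNorm L j ≠ 0 := by
  rw [piNorm]
  split_ifs with hj
  · exact_mod_cast one_div_ne_zero hL
  · have : (j : ℝ) ≠ 0 := by exact_mod_cast hj
    exact_mod_cast div_ne_zero (mul_ne_zero Real.pi_ne_zero this) hL

theorem prod_Icc_neg_eq_mul_prod_range {M : Type*} [CommMonoid M] (f : ℤ → M) (N : ℕ) :
    ∏ j ∈ Finset.Icc (-(N : ℤ)) N, f j =
      f 0 * ∏ k ∈ Finset.range N, (f (k + 1) * f (-(k + 1))) := by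
  induction N with
  | zero => simp
  | succ N ih =>
    have h : Finset.Icc (-((N + 1 : ℕ) : ℤ)) ((N + 1 : ℕ) : ℤ) =
        insert ((N : ℤ) + 1) (insert (-((N : ℤ) + 1)) (Finset.Icc (-(N : ℤ)) N)) := by
      ext j
      simp only [Finset.mem_Icc, Finset.mem_insert]
      push_cast
      omega
    rw [h, Finset.prod_insert (by simp; omega), Finset.prod_insert (by simp), ih,
      Finset.prod_range_succ, mul_comm _ (f (N + 1) * f (-(N + 1))), mul_left_comm (f 0), mul_assoc]

theorem sum_Icc_neg_natAbs_le (g : ℕ → ℝ) (hg : ∀ k, 0 ≤ g k) (N : ℕ) :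
    ∑ j ∈ Finset.Icc (-(N : ℤ)) N, g j.natAbs ≤ 2 * ∑ k ∈ Finset.range (N + 1), g k := by
  rw [Finset.sum_Icc_of_even_eq_range (f := fun j : ℤ => g j.natAbs) (fun j => by simp)]
  simpa using hg 0

/-- The larger of p and m is at least their mean. A power 1/4 taken from it provides decay in p + m,
and the rest is bounded by the smaller one to the summable power -5/4. -/
theorem one_div_sqrt_mul_le {p m : ℝ} (hp : 0 < p) (hm : 0 < m) :
    1 / (√p * m) ≤ ((p + m) / 2) ^ (-(1 / 4) : ℝ) * (p ^ (-(5 / 4) : ℝ) + m ^ (-(5 / 4) : ℝ)) := by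
  have hs : 1 / (√p * m) = p ^ (-(1 / 2) : ℝ) * m ^ (-1 : ℝ) := by
    rw [Real.sqrt_eq_rpow, Real.rpow_neg hp.le, Real.rpow_neg hm.le, Real.rpow_one, one_div,
      mul_inv]
  rw [hs]
  have hpm : 0 < (p + m) / 2 := by positivity
  have h1 : 0 ≤ ((p + m) / 2) ^ (-(1 / 4) : ℝ) := by positivity
  have h2 : 0 ≤ p ^ (-(5 / 4) : ℝ) := by positivity
  have h3 : 0 ≤ m ^ (-(5 / 4) : ℝ) := by positivity
  rcases le_total p m with h | h
  · calc p ^ (-(1 / 2) : ℝ) * m ^ (-1 : ℝ)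
        = p ^ (-(1 / 2) : ℝ) * (m ^ (-(3 / 4) : ℝ) * m ^ (-(1 / 4) : ℝ)) := by
          rw [← Real.rpow_add hm]; norm_num
      _ ≤ p ^ (-(1 / 2) : ℝ) * (p ^ (-(3 / 4) : ℝ) * ((p + m) / 2) ^ (-(1 / 4) : ℝ)) := by
          gcongr ?_ * (?_ * ?_)
          · exact Real.rpow_le_rpow_of_nonpos hp h (by norm_num)
          · exact Real.rpow_le_rpow_of_nonpos hpm (by linarith) (by norm_num)
      _ = ((p + m) / 2) ^ (-(1 / 4) : ℝ) * p ^ (-(5 / 4) : ℝ) := by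
          rw [← mul_assoc, ← Real.rpow_add hp, mul_comm]; norm_num
      _ ≤ _ := by gcongr; linarith
  · calc p ^ (-(1 / 2) : ℝ) * m ^ (-1 : ℝ)
        = p ^ (-(1 / 4) : ℝ) * (p ^ (-(1 / 4) : ℝ) * m ^ (-1 : ℝ)) := by
          rw [← mul_assoc, ← Real.rpow_add hp]; norm_num
      _ ≤ ((p + m) / 2) ^ (-(1 / 4) : ℝ) * (m ^ (-(1 / 4) : ℝ) * m ^ (-1 : ℝ)) := by
          gcongr ?_ * (?_ * _)
          · exact Real.rpow_le_rpow_of_nonpos hpm (by linarith) (by norm_num)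
          · exact Real.rpow_le_rpow_of_nonpos hm h (by norm_num)
      _ = ((p + m) / 2) ^ (-(1 / 4) : ℝ) * m ^ (-(5 / 4) : ℝ) := by
          rw [← Real.rpow_add hm]; norm_num
      _ ≤ _ := by gcongr; linarith

/-- The deviation of a canonical product from the sine product on the boundary of a large square
is controlled by this sum. -/
def boundarySum (N : ℕ) : ℝ :=
  ∑ j ∈ Finset.Icc (-(N : ℤ)) N, 1 / (√((j.natAbs : ℝ) + 1) * (N + 1 / 2 - j.natAbs))

theorem tendsto_boundarySum : Tendsto boundarySum atTop (𝓝 0) := by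
  have hsum : Summable fun k : ℕ => ((k : ℝ) + 1) ^ (-(5 / 4) : ℝ) := by
    have := (summable_nat_add_iff 1).2 (Real.summable_nat_rpow.2 (by norm_num : -(5 / 4 : ℝ) < -1))
    simpa using this
  set A := ∑' k : ℕ, ((k : ℝ) + 1) ^ (-(5 / 4) : ℝ) with hA
  have hlim : Tendsto (fun N : ℕ => 8 * A * (((N : ℝ) + 2) / 2) ^ (-(1 / 4) : ℝ)) atTop (𝓝 0) := by
    have h1 : Tendsto (fun N : ℕ => ((N : ℝ) + 2) / 2) atTop atTop :=
      (tendsto_natCast_atTop_atTop.atTop_add tendsto_const_nhds).atTop_div_const two_pos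
    simpa using ((tendsto_rpow_neg_atTop (by norm_num : (0 : ℝ) < 1 / 4)).comp h1).const_mul (8 * A)
  refine squeeze_zero (fun N => ?_) (fun N => ?_) hlim
  · refine Finset.sum_nonneg fun j hj => ?_
    have : (j.natAbs : ℝ) ≤ N := by
      rw [Finset.mem_Icc] at hj
      exact_mod_cast (by omega : j.natAbs ≤ N)
    have : 0 ≤ (N : ℝ) + 1 / 2 - j.natAbs := by linarith
    positivity
  set c := (((N : ℝ) + 2) / 2) ^ (-(1 / 4) : ℝ) with hc
  have hc0 : 0 ≤ c := by positivity
  set g : ℕ → ℝ := fun k => 2 * c * (((k : ℝ) + 1) ^ (-(5 / 4) : ℝ) +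
    (((N - k : ℕ) : ℝ) + 1) ^ (-(5 / 4) : ℝ)) with hg
  calc boundarySum N ≤ ∑ j ∈ Finset.Icc (-(N : ℤ)) N, g j.natAbs := by
        refine Finset.sum_le_sum fun j hj => ?_
        have hjN : j.natAbs ≤ N := by
          rw [Finset.mem_Icc] at hj
          omega
        have hjN' : (j.natAbs : ℝ) ≤ N := by exact_mod_cast hjN
        -- The arguments are chosen with constant sum N + 2, so the decaying factor does not depend
        -- on j. Replacing N + 1/2 - |j| by half of N - |j| + 1 costs the factor 2.
        have := one_div_sqrt_mul_le (p := (j.natAbs : ℝ) + 1) (m := ((N - j.natAbs : ℕ) : ℝ) + 1)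
          (by positivity) (by positivity)
        simp only [hg]
        rw [Nat.cast_sub hjN] at this ⊢
        rw [show ((j.natAbs : ℝ) + 1 + ((N : ℝ) - j.natAbs + 1)) / 2 = ((N : ℝ) + 2) / 2 by ring,
          ← hc] at this
        have h2 : 0 < √((j.natAbs : ℝ) + 1) := Real.sqrt_pos.2 (by positivity)
        calc _ ≤ 1 / (√((j.natAbs : ℝ) + 1) * (((N : ℝ) - j.natAbs + 1) / 2)) := by
              apply one_div_le_one_div_of_le
              · have : 0 < (N : ℝ) - j.natAbs + 1 := by linarith
                positivity
              · gcongr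
                linarith
          _ = 2 * (1 / (√((j.natAbs : ℝ) + 1) * ((N : ℝ) - j.natAbs + 1))) := by
              have : 0 < (N : ℝ) - j.natAbs + 1 := by linarith
              field_simp
          _ ≤ _ := by linarith
    _ ≤ 2 * ∑ k ∈ Finset.range (N + 1), g k :=
        sum_Icc_neg_natAbs_le g (fun k => by positivity) N
    _ = 8 * c * ∑ k ∈ Finset.range (N + 1), ((k : ℝ) + 1) ^ (-(5 / 4) : ℝ) := by
        simp only [hg]
        rw [← Finset.mul_sum, Finset.sum_add_distrib]
        have := Finset.sum_range_reflect (fun k : ℕ => ((k : ℝ) + 1) ^ (-(5 / 4) : ℝ)) (N + 1)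
        simp only [Nat.add_sub_cancel] at this
        rw [this]
        ring
    _ ≤ 8 * c * A := by
        gcongr
        exact hsum.sum_le_tsum _ fun k _ => by positivity
    _ = _ := by ring

/-- Half-integer multiples of π keep the square away from the zeros: on vertical sides |Re sin w| =
cosh(Im w), and on horizontal sides |Im w| ≥ 3/2, so one exponential dominates the other. -/
theorem exp_abs_im_le_four_mul_norm_sin {w : ℂ} {N : ℕ}
    (h : |w.re| = (N + 1 / 2) * Real.pi ∨ |w.im| = (N + 1 / 2) * Real.pi) :
    Real.exp |w.im| ≤ 4 * ‖sin w‖ := by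
  rcases h with h | h
  · have hcos : Real.cos w.re = 0 := by
      rw [← Real.cos_abs, h, Real.cos_eq_zero_iff]
      exact ⟨N, by push_cast; ring⟩
    have hsin : |Real.sin w.re| = 1 := by
      have := Real.sin_sq_add_cos_sq w.re
      rw [hcos] at this
      rw [← sq_eq_sq₀ (abs_nonneg _) zero_le_one, sq_abs]
      linarith
    have hre : (sin w).re = Real.sin w.re * Real.cosh w.im := by
      rw [Complex.sin_eq, ← Complex.ofReal_sin, ← Complex.ofReal_cosh, ← Complex.ofReal_cos,
        ← Complex.ofReal_sinh]
      simp [Complex.sin_ofReal_re]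
    have h1 := Complex.abs_re_le_norm (sin w)
    rw [hre, abs_mul, hsin, one_mul, abs_of_pos (Real.cosh_pos _), ← Real.cosh_abs,
      Real.cosh_eq] at h1
    linarith [Real.exp_pos (-|w.im|), Real.exp_pos |w.im|]
  · have hpi : 3 / 2 ≤ |w.im| := by
      rw [h]
      have := Real.pi_gt_three
      have : (0 : ℝ) ≤ N := N.cast_nonneg
      nlinarith
    have h1 : Real.exp |w.im| - Real.exp (-|w.im|) ≤ 2 * ‖sin w‖ := by
      have e : ‖sin w‖ = ‖exp (-w * I) - exp (w * I)‖ / 2 := by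
        rw [Complex.sin, norm_div, norm_mul, norm_I, mul_one, RCLike.norm_ofNat]
      rw [e]
      have n1 : ‖exp (-w * I)‖ = Real.exp w.im := by rw [Complex.norm_exp]; simp
      have n2 : ‖exp (w * I)‖ = Real.exp (-w.im) := by rw [Complex.norm_exp]; simp
      have := abs_norm_sub_norm_le (exp (-w * I)) (exp (w * I))
      rw [n1, n2] at this
      rcases abs_cases w.im with ⟨h, _⟩ | ⟨h, _⟩
      · rw [h]; linarith [le_abs_self (Real.exp w.im - Real.exp (-w.im))]
      · rw [h, neg_neg]; linarith [neg_abs_le (Real.exp w.im - Real.exp (-w.im))]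
    have h2 : Real.exp (-|w.im|) ≤ 1 := Real.exp_le_one_iff.2 (by linarith)
    have h3 := Real.add_one_le_exp |w.im|
    linarith

/-- Pairing j with -j turns this into Euler's product. The factor at j = 0 is -zL because π_0 = 1/L,
which is where the minus sign originates. -/
theorem tendsto_prod_sineZero {L : ℝ} (hL : L ≠ 0) (z : ℂ) :
    Tendsto (fun N : ℕ => ∏ j ∈ Finset.Icc (-(N : ℤ)) N, (sineZero L j - z) / piNorm L j) atTop
      (𝓝 (-sin (z * L))) := by
  have hLc : (L : ℂ) ≠ 0 := by exact_mod_cast hL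
  have hpi : (Real.pi : ℂ) ≠ 0 := by exact_mod_cast Real.pi_ne_zero
  have h := (Complex.tendsto_euler_sin_prod (z * L / Real.pi)).neg
  rw [mul_div_cancel₀ _ hpi] at h
  refine h.congr fun N => ?_
  rw [prod_Icc_neg_eq_mul_prod_range]
  have h0 : (sineZero L 0 - z) / piNorm L 0 = -(z * L) := by
    simp [sineZero, piNorm]
  rw [h0, neg_mul]
  congr 2
  refine Finset.prod_congr rfl fun k _ => ?_
  have hk : ((k : ℂ) + 1) ≠ 0 := by exact_mod_cast k.succ_ne_zero
  have hk1 : ((k : ℤ) + 1) ≠ 0 := by omega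
  have hk2 : -((k : ℤ) + 1) ≠ 0 := by omega
  rw [piNorm, piNorm, if_neg hk1, if_neg hk2, sineZero, sineZero]
  push_cast
  field_simp
  ring

/-! ### Entire functions as canonical products. -/

section

theorem analyticOrderAt_const_sub_self (a : ℂ) : analyticOrderAt (fun z : ℂ => a - z) a = 1 := by
  apply AnalyticAt.analyticOrderAt_eq_one_of_zero_deriv_ne_zero
  · fun_prop
  · simp
  · simp

theorem analyticOrderAt_const_sub_of_ne {a w : ℂ} (h : a ≠ w) :
    analyticOrderAt (fun z : ℂ => a - z) w = 0 :=
  analyticOrderAt_eq_zero.2 (Or.inr (sub_ne_zero.2 h))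

/-- Finitely many zeros can be divided out of an entire function. -/
theorem exists_eq_prod_mul {α : Type*} (s : Finset α) (a : α → ℂ) {f : ℂ → ℂ}
    (hf : Differentiable ℂ f)
    (h : ∀ w, ({p | p ∈ s ∧ a p = w} : Set α).encard ≤ analyticOrderAt f w) :
    ∃ g : ℂ → ℂ, Differentiable ℂ g ∧ ∀ z, f z = (∏ p ∈ s, (a p - z)) * g z := by
  classical
  induction s using Finset.induction_on generalizing f with
  | empty => exact ⟨f, hf, fun z => by simp⟩
  | insert p s hp ih =>
    have hfp : f (a p) = 0 := by
      refine apply_eq_zero_of_analyticOrderAt_ne_zero fun h0 => ?_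
      have h1 := h (a p)
      rw [h0, nonpos_iff_eq_zero, Set.encard_eq_zero] at h1
      have : p ∈ ({p' | p' ∈ insert p s ∧ a p' = a p} : Set α) := by simp
      rw [h1] at this
      exact this
    set g : ℂ → ℂ := fun z => -dslope f (a p) z with hg
    have hgd : Differentiable ℂ g := by
      have := (Complex.differentiableOn_dslope (f := f) (c := a p) univ_mem).2 hf.differentiableOn
      exact (differentiableOn_univ.1 this).neg
    have hfg : ∀ z, f z = (a p - z) * g z := fun z => by
      have := sub_smul_dslope f (a p) z
      rw [hfp, sub_zero, smul_eq_mul] at this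
      rw [← this]
      simp only [hg]
      ring
    have hord : ∀ w, analyticOrderAt f w =
        analyticOrderAt (fun z : ℂ => a p - z) w + analyticOrderAt g w := fun w => by
      rw [show f = (fun z : ℂ => a p - z) * g from funext hfg]
      exact analyticOrderAt_mul (by fun_prop) (hgd.analyticAt w)
    obtain ⟨k, hk, hgk⟩ := ih hgd (fun w => by
      have h1 := h w
      rw [hord] at h1
      by_cases hw : a p = w
      · rw [← hw, analyticOrderAt_const_sub_self, add_comm] at h1
        have e : ({p' | p' ∈ insert p s ∧ a p' = a p} : Set α) =
            insert p {p' | p' ∈ s ∧ a p' = a p} := by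
          ext p'
          simp only [Finset.mem_insert, Set.mem_ofPred_eq, Set.mem_insert_iff]
          constructor
          · rintro ⟨h | h, h'⟩ <;> tauto
          · rintro (h | h)
            · simp [h]
            · tauto
        rw [e, Set.encard_insert_of_notMem (by simp [hp])] at h1
        rw [← hw]
        exact (ENat.add_le_add_iff_right (by simp)).1 h1
      · rw [analyticOrderAt_const_sub_of_ne hw, zero_add] at h1
        refine le_trans (Set.encard_le_encard ?_) h1
        rintro p' ⟨h2, h3⟩
        exact ⟨Finset.mem_insert_of_mem h2, h3⟩)
    refine ⟨k, hk, fun z => ?_⟩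
    rw [hfg, hgk, Finset.prod_insert hp, mul_assoc]

variable {L : ℝ}

theorem sineZero_injective (hL : L ≠ 0) : Function.Injective (sineZero L) := by
  intro i j h
  simp only [sineZero, Complex.ofReal_inj] at h
  field_simp at h
  exact_mod_cast h

theorem sin_sineZero_mul (hL : L ≠ 0) (j : ℤ) : sin (sineZero L j * L) = 0 := by
  rw [Complex.sin_eq_zero_iff]
  refine ⟨j, ?_⟩
  have hLc : (L : ℂ) ≠ 0 := by exact_mod_cast hL
  rw [sineZero]
  push_cast
  field_simp

theorem hasDerivAt_sin_mul (L : ℝ) (z : ℂ) :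
    HasDerivAt (fun z : ℂ => sin (z * L)) (cos (z * L) * L) z := by
  simpa using (hasDerivAt_mul_const (L : ℂ) (x := z)).csin

theorem cos_ne_zero_of_sin_eq_zero {w : ℂ} (h : sin w = 0) : cos w ≠ 0 := by
  intro h'
  have := Complex.sin_sq_add_cos_sq w
  simp [h, h'] at this

/-- The sine function without its zeros with labels `|j| ≤ N`. -/
theorem exists_sin_eq_prod_mul (hL : 0 < L) (N : ℕ) : ∃ T : ℂ → ℂ, Differentiable ℂ T ∧
    (∀ z, sin (z * L) = (∏ j ∈ Finset.Icc (-(N : ℤ)) N, (sineZero L j - z)) * T z) ∧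
    ∀ z : ℂ, |z.re| * L < (N + 1) * Real.pi → T z ≠ 0 := by
  have hd : Differentiable ℂ fun z : ℂ => sin (z * L) := fun z =>
    (hasDerivAt_sin_mul L z).differentiableAt
  obtain ⟨T, hT, hsin⟩ := exists_eq_prod_mul (Finset.Icc (-(N : ℤ)) N) (sineZero L) hd (fun w => by
    by_cases hw : sin (w * L) = 0
    · rw [(hd.analyticAt w).analyticOrderAt_eq_one_of_zero_deriv_ne_zero hw (by
        rw [(hasDerivAt_sin_mul L w).deriv]
        exact mul_ne_zero (cos_ne_zero_of_sin_eq_zero hw) (by exact_mod_cast hL.ne'))]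
      rw [Set.encard_le_one_iff]
      rintro i j ⟨-, hi⟩ ⟨-, hj⟩
      exact sineZero_injective hL.ne' (hi.trans hj.symm)
    · rw [Set.encard_eq_zero.2]
      · exact zero_le
      · rw [Set.eq_empty_iff_forall_notMem]
        rintro j ⟨-, rfl⟩
        exact hw (sin_sineZero_mul hL.ne' j))
  refine ⟨T, hT, hsin, fun z hz hTz => ?_⟩
  have hs : sin (z * L) = 0 := by rw [hsin, hTz, mul_zero]
  obtain ⟨k, hk⟩ := Complex.sin_eq_zero_iff.1 hs
  have hre : z.re * L = k * Real.pi := by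
    have := congrArg Complex.re hk
    simpa using this
  have hkN : |(k : ℝ)| < N + 1 := by
    have : |(k : ℝ)| * Real.pi < (N + 1) * Real.pi := by
      rw [← abs_of_pos Real.pi_pos, ← abs_mul, ← hre, abs_mul, abs_of_pos hL,
        abs_of_pos Real.pi_pos]
      exact hz
    exact lt_of_mul_lt_mul_right this Real.pi_pos.le
  have hkN' : |k| < N + 1 := by exact_mod_cast hkN
  have hzk : sineZero L k = z := by
    have hLc : (L : ℂ) ≠ 0 := by exact_mod_cast hL.ne'
    rw [sineZero]
    push_cast
    rw [div_eq_iff hLc, hk, mul_comm]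
  have hS : ∏ j ∈ Finset.Icc (-(N : ℤ)) N, (sineZero L j - z) = 0 := by
    refine Finset.prod_eq_zero (i := k) ?_ (by rw [hzk, sub_self])
    rw [abs_lt] at hkN'
    rw [Finset.mem_Icc]
    omega
  -- If the cofactor vanished at a listed zero, the sine would have a double zero there,
  -- contradicting the nonvanishing of its derivative.
  have hP : DifferentiableAt ℂ
      (fun z => ∏ j ∈ Finset.Icc (-(N : ℤ)) N, (sineZero L j - z)) z := by fun_prop
  have h1 := hP.hasDerivAt.fun_mul (hT z).hasDerivAt
  rw [hTz, hS, mul_zero, zero_mul, add_zero] at h1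
  have h2 := (hasDerivAt_sin_mul L z).unique (by rw [funext hsin]; exact h1)
  exact mul_ne_zero (cos_ne_zero_of_sin_eq_zero hs) (by exact_mod_cast hL.ne') h2

/-- Comparison of an entire function with its canonical product over an exhausting sequence of
squares. -/
theorem exists_quotient_near_const {ι : Type*} [Fintype ι] (hL : 0 < L) {f : ℂ → ℂ}
    (hf : Differentiable ℂ f) (a : ι → ℤ → ℂ)
    (hord : ∀ w, ({p | a p.1 p.2 = w} : Set (ι × ℤ)).encard ≤ analyticOrderAt f w)
    {C : ℝ} (hC : 0 ≤ C)
    (ha : ∀ i j, ‖a i j - sineZero L j‖ ≤ C / √((j.natAbs : ℝ) + 1))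
    {c : ℂ} {K : ℝ} (hK : 0 ≤ K) (hasym : ∀ z : ℂ, z ≠ 0 →
      ‖f z - c * sin (z * L) ^ Fintype.card ι‖ ≤
        K * Real.exp (|z.im| * L) ^ Fintype.card ι / ‖z‖) :
    ∃ η : ℕ → ℝ, Tendsto η atTop (𝓝 0) ∧ ∀ᶠ N : ℕ in atTop, ∀ z : ℂ,
      |z.re| * L < (N + 1 / 2) * Real.pi → |z.im| * L < (N + 1 / 2) * Real.pi →
      ∃ h : ℂ, ‖h - c‖ ≤ η N ∧
        (∏ j ∈ Finset.Icc (-(N : ℤ)) N, ∏ i, (a i j - z)) * h * sin (z * L) ^ Fintype.card ι =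
          f z * (∏ j ∈ Finset.Icc (-(N : ℤ)) N, (sineZero L j - z)) ^ Fintype.card ι := by
  set m := Fintype.card ι with hm
  set κ := Real.pi / L with hκ
  have hκ0 : 0 < κ := div_pos Real.pi_pos hL
  have hκL : κ * L = Real.pi := div_mul_cancel₀ _ hL.ne'
  set e₁ : ℕ → ℝ := fun N => K * 4 ^ m / (κ * (N + 1 / 2)) with he₁
  set e₂ : ℕ → ℝ := fun N => Real.exp (m * (C / κ) * boundarySum N) - 1 with he₂
  have ht₁ : Tendsto e₁ atTop (𝓝 0) := by
    have : Tendsto (fun N : ℕ => κ * ((N : ℝ) + 1 / 2)) atTop atTop :=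
      (tendsto_natCast_atTop_atTop.atTop_add tendsto_const_nhds).const_mul_atTop hκ0
    exact tendsto_const_nhds.div_atTop this
  have ht₂ : Tendsto e₂ atTop (𝓝 0) := by
    have h1 := (tendsto_boundarySum.const_mul (m * (C / κ))).rexp.sub_const 1
    simpa using h1
  refine ⟨fun N => 2 * (e₁ N + ‖c‖ * e₂ N), ?_, ?_⟩
  · simpa using (ht₁.add (ht₂.const_mul ‖c‖)).const_mul 2
  filter_upwards [ht₂.eventually (Iic_mem_nhds (show (0 : ℝ) < 1 / 2 by norm_num))] with N hN z hzre
    hzim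
  replace hN : e₂ N ≤ 1 / 2 := hN
  obtain ⟨G, hG, hfG⟩ := exists_eq_prod_mul ((Finset.Icc (-(N : ℤ)) N) ×ˢ (Finset.univ : Finset ι))
    (fun p => a p.2 p.1) hf (fun w => by
      refine le_trans ?_ (hord w)
      rw [← Function.Injective.encard_image (Prod.swap_injective (α := ℤ) (β := ι))]
      refine Set.encard_le_encard ?_
      rintro _ ⟨p, ⟨-, hp⟩, rfl⟩
      exact hp)
  obtain ⟨T, hT, hsinT, hT0⟩ := exists_sin_eq_prod_mul hL N
  set P : ℂ → ℂ := fun z => ∏ j ∈ Finset.Icc (-(N : ℤ)) N, ∏ i, (a i j - z) with hP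
  set S : ℂ → ℂ := fun z => ∏ j ∈ Finset.Icc (-(N : ℤ)) N, (sineZero L j - z) with hS
  have hfP : ∀ z, f z = P z * G z := fun z => by rw [hfG, Finset.prod_product]
  set R := (N + 1 / 2) * κ with hR
  have hR0 : 0 < R := by positivity
  have hRL : R * L = (N + 1 / 2) * Real.pi := by rw [hR, mul_assoc, hκL]
  set V : Set ℂ := {z | |z.re| < R ∧ |z.im| < R} with hV
  have hre : Continuous fun z : ℂ => |z.re| := by fun_prop
  have him : Continuous fun z : ℂ => |z.im| := by fun_prop
  have hVo : IsOpen V := (isOpen_lt hre continuous_const).and (isOpen_lt him continuous_const)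
  have hVc : closure V ⊆ {z | |z.re| ≤ R ∧ |z.im| ≤ R} :=
    closure_minimal (fun z hz => ⟨hz.1.le, hz.2.le⟩)
      ((isClosed_le hre continuous_const).and (isClosed_le him continuous_const))
  have hVb : Bornology.IsBounded V := by
    refine (Metric.isBounded_closedBall (x := (0 : ℂ)) (r := R + R)).subset fun z hz => ?_
    rw [mem_closedBall_zero_iff]
    exact (Complex.norm_le_abs_re_add_abs_im z).trans (add_le_add hz.1.le hz.2.le)
  have hTV : ∀ z ∈ closure V, T z ≠ 0 := fun z hz => hT0 z (by
    have h1 : |z.re| * L ≤ R * L := by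
      have := (hVc hz).1
      gcongr
    rw [hRL] at h1
    nlinarith [Real.pi_pos])
  -- G and T are f and the sine with their labelled zeros removed. Since G/T^m is f/sin^m divided by
  -- Q = P/S^m, it is close to c wherever both quotients are controlled.
  have hfront : ∀ z ∈ frontier V, ‖G z / T z ^ m - c‖ ≤ 2 * (e₁ N + ‖c‖ * e₂ N) := by
    intro z hz
    rw [hVo.frontier_eq] at hz
    have hzc := hVc hz.1
    have hzR : |z.re| = R ∨ |z.im| = R := by
      by_contra! hne
      exact hz.2 ⟨lt_of_le_of_ne hzc.1 hne.1, lt_of_le_of_ne hzc.2 hne.2⟩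
    have hnorm : R ≤ ‖z‖ := by
      rcases hzR with h | h
      · exact h ▸ Complex.abs_re_le_norm z
      · exact h ▸ Complex.abs_im_le_norm z
    have hz0 : z ≠ 0 := norm_pos_iff.1 (hR0.trans_le hnorm)
    have hsinb : Real.exp (|z.im| * L) ≤ 4 * ‖sin (z * L)‖ := by
      have := exp_abs_im_le_four_mul_norm_sin (w := z * L) (N := N) (by
        simp only [Complex.mul_re, Complex.mul_im, Complex.ofReal_re, Complex.ofReal_im, mul_zero,
          sub_zero, zero_add, abs_mul, abs_of_pos hL, ← hRL]
        rcases hzR with h | h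
        · left; rw [h]
        · right; rw [h])
      simpa [abs_mul, abs_of_pos hL] using this
    have hsin0 : sin (z * L) ≠ 0 := by
      intro h0
      rw [h0, norm_zero, mul_zero] at hsinb
      exact absurd hsinb (not_le.2 (Real.exp_pos _))
    have hdist : ∀ j ∈ Finset.Icc (-(N : ℤ)) N,
        κ * (N + 1 / 2 - j.natAbs) ≤ ‖sineZero L j - z‖ := by
      intro j hj
      have hja : |(sineZero L j).re| = κ * j.natAbs := by
        rw [sineZero, Complex.ofReal_re, mul_comm, mul_div_assoc, abs_mul, ← hκ, abs_of_pos hκ0,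
          Nat.cast_natAbs, Int.cast_abs, mul_comm]
      rcases hzR with h | h
      · have h1 := Complex.abs_re_le_norm (sineZero L j - z)
        have h2 := abs_sub_abs_le_abs_sub z.re (sineZero L j).re
        rw [Complex.sub_re, abs_sub_comm] at h1
        rw [h, hja] at h2
        have : R - κ * j.natAbs = κ * (N + 1 / 2 - j.natAbs) := by rw [hR]; ring
        linarith
      · have h1 := Complex.abs_im_le_norm (sineZero L j - z)
        have h0 : (sineZero L j).im = 0 := by rw [sineZero, Complex.ofReal_im]
        rw [Complex.sub_im, h0, zero_sub, abs_neg, h] at h1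
        have : 0 ≤ κ * j.natAbs := by positivity
        have : R - κ * j.natAbs = κ * (N + 1 / 2 - j.natAbs) := by rw [hR]; ring
        linarith
    have hpos : ∀ j ∈ Finset.Icc (-(N : ℤ)) N, 0 < (N : ℝ) + 1 / 2 - j.natAbs := by
      intro j hj
      have : (j.natAbs : ℝ) ≤ N := by
        rw [Finset.mem_Icc] at hj
        exact_mod_cast (by omega : j.natAbs ≤ N)
      linarith
    have hne : ∀ j ∈ Finset.Icc (-(N : ℤ)) N, sineZero L j - z ≠ 0 := fun j hj =>
      norm_pos_iff.1 ((mul_pos hκ0 (hpos j hj)).trans_le (hdist j hj))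
    have hS0 : S z ≠ 0 := Finset.prod_ne_zero_iff.2 hne
    have hQ : ‖P z / S z ^ m - 1‖ ≤ e₂ N := by
      have e : P z / S z ^ m = ∏ p ∈ (Finset.Icc (-(N : ℤ)) N) ×ˢ (Finset.univ : Finset ι),
          (1 + (a p.2 p.1 - sineZero L p.1) / (sineZero L p.1 - z)) := by
        rw [Finset.prod_product, hP, hS, ← Finset.prod_pow, ← Finset.prod_div_distrib]
        refine Finset.prod_congr rfl fun j hj => ?_
        rw [hm, ← Finset.card_univ, ← Finset.prod_const, ← Finset.prod_div_distrib]
        refine Finset.prod_congr rfl fun i _ => ?_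
        have := hne j hj
        field_simp
        ring
      rw [e]
      refine (Finset.norm_prod_one_add_sub_one_le _ _).trans ?_
      rw [he₂, sub_le_sub_iff_right, Real.exp_le_exp, Finset.sum_product, boundarySum,
        Finset.mul_sum]
      refine Finset.sum_le_sum fun j hj => ?_
      have : ∀ i ∈ (Finset.univ : Finset ι), ‖(a i j - sineZero L j) / (sineZero L j - z)‖ ≤
          C / κ * (1 / (√((j.natAbs : ℝ) + 1) * (N + 1 / 2 - j.natAbs))) := by
        intro i _
        rw [norm_div]
        have h1 := ha i j
        have h2 := hdist j hj
        have h3 := hpos j hj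
        have h4 : 0 < √((j.natAbs : ℝ) + 1) := Real.sqrt_pos.2 (by positivity)
        calc _ ≤ (C / √((j.natAbs : ℝ) + 1)) / (κ * (N + 1 / 2 - j.natAbs)) := by gcongr
          _ = _ := by field_simp
      refine (Finset.sum_le_card_nsmul _ _ _ this).trans ?_
      rw [Finset.card_univ, ← hm, nsmul_eq_mul, ← mul_assoc]
    have hF : ‖f z / sin (z * L) ^ m - c‖ ≤ e₁ N := by
      have hsm : sin (z * L) ^ m ≠ 0 := pow_ne_zero _ hsin0
      rw [show f z / sin (z * L) ^ m - c = (f z - c * sin (z * L) ^ m) / sin (z * L) ^ m by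
        field_simp, norm_div, norm_pow, div_le_iff₀ (pow_pos (norm_pos_iff.2 hsin0) _)]
      refine (hasym z hz0).trans ?_
      have h1 : Real.exp (|z.im| * L) ^ m ≤ 4 ^ m * ‖sin (z * L)‖ ^ m := by
        rw [← mul_pow]
        gcongr
      calc _ ≤ K * (4 ^ m * ‖sin (z * L)‖ ^ m) / R := by gcongr
        _ = e₁ N * ‖sin (z * L)‖ ^ m := by rw [he₁, hR]; ring
    set Q := P z / S z ^ m with hQdef
    -- This lower bound, from `e₂ N ≤ 1/2`, accounts for the factor 2 in the final error.
    have hQ0 : 1 / 2 ≤ ‖Q‖ := by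
      have := norm_sub_norm_le (1 : ℂ) Q
      rw [norm_sub_rev, norm_one] at this
      linarith
    have hQne : Q ≠ 0 := norm_pos_iff.1 (by linarith)
    have hT0z := hTV z hz.1
    have hGT : G z / T z ^ m * Q = f z / sin (z * L) ^ m := by
      rw [hQdef, hfP, hsinT]
      have : (∏ j ∈ Finset.Icc (-(N : ℤ)) N, (sineZero L j - z)) = S z := rfl
      rw [this, mul_pow]
      field_simp
    have e : G z / T z ^ m - c = ((f z / sin (z * L) ^ m - c) - c * (Q - 1)) / Q := by
      rw [eq_div_iff hQne, ← hGT]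
      ring
    rw [e, norm_div, div_le_iff₀ (by linarith)]
    have h1 := norm_sub_le (f z / sin (z * L) ^ m - c) (c * (Q - 1))
    rw [norm_mul] at h1
    have h2 : ‖c‖ * ‖Q - 1‖ ≤ ‖c‖ * e₂ N := by gcongr
    have h3 : 0 ≤ e₁ N + ‖c‖ * e₂ N := by
      have := (norm_nonneg _).trans hF
      have := (norm_nonneg _).trans hQ
      positivity
    nlinarith
  have hzV : z ∈ V := by
    constructor
    · exact lt_of_mul_lt_mul_right (hRL ▸ hzre) hL.le
    · exact lt_of_mul_lt_mul_right (hRL ▸ hzim) hL.le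
  refine ⟨G z / T z ^ m, ?_, ?_⟩
  -- T has no zeros on the closed square, so the quotient is holomorphic there and the maximum
  -- principle carries the boundary estimate inside.
  · refine Complex.norm_le_of_forall_mem_frontier_norm_le (f := fun z => G z / T z ^ m - c) hVb
      (DifferentiableOn.diffContOnCl fun w hw => ?_) hfront (subset_closure hzV)
    exact (((hG w).div ((hT w).fun_pow m) (pow_ne_zero _ (hTV w hw))).sub_const
      c).differentiableWithinAt
  · have hT0z := hTV z (subset_closure hzV)
    rw [hsinT, hfP, mul_pow]
    field_simp
    simp only [hP]
    ring

/-- **Canonical products.** An entire function which is asymptotic to `c sin(zL)^m` is the product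
over its zeros, if these are labelled so as to be close to those of the sine function. -/
theorem tendsto_canonicalProduct {ι : Type*} [Fintype ι] (hL : 0 < L) {f : ℂ → ℂ}
    (hf : Differentiable ℂ f) (a : ι → ℤ → ℂ)
    (hord : ∀ w, ({p | a p.1 p.2 = w} : Set (ι × ℤ)).encard ≤ analyticOrderAt f w)
    {C : ℝ} (hC : 0 ≤ C)
    (ha : ∀ i j, ‖a i j - sineZero L j‖ ≤ C / √((j.natAbs : ℝ) + 1))
    {c : ℂ} (hc : c ≠ 0) {K : ℝ} (hK : 0 ≤ K) (hasym : ∀ z : ℂ, z ≠ 0 →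
      ‖f z - c * sin (z * L) ^ Fintype.card ι‖ ≤
        K * Real.exp (|z.im| * L) ^ Fintype.card ι / ‖z‖)
    {z : ℂ} (hz : sin (z * L) ≠ 0) :
    Tendsto (fun N : ℕ => ∏ j ∈ Finset.Icc (-(N : ℤ)) N, ∏ i, ((a i j - z) / piNorm L j)) atTop
      (𝓝 ((-1) ^ Fintype.card ι * f z / c)) := by
  obtain ⟨η, hη, hquot⟩ := exists_quotient_near_const hL hf a hord hC ha hK hasym
  set m := Fintype.card ι with hm
  have hlarge : ∀ x : ℝ, ∀ᶠ N : ℕ in atTop, |x| * L < ((N : ℝ) + 1 / 2) * Real.pi := fun x =>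
    ((tendsto_natCast_atTop_atTop.atTop_add tendsto_const_nhds).atTop_mul_const
      Real.pi_pos).eventually_gt_atTop _
  have hex : ∀ᶠ N : ℕ in atTop, ∃ h : ℂ, ‖h - c‖ ≤ η N ∧
      (∏ j ∈ Finset.Icc (-(N : ℤ)) N, ∏ i, (a i j - z)) * h * sin (z * L) ^ m =
        f z * (∏ j ∈ Finset.Icc (-(N : ℤ)) N, (sineZero L j - z)) ^ m := by
    filter_upwards [hquot, hlarge z.re, hlarge z.im] with N h1 h2 h3 using h1 z h2 h3
  obtain ⟨h, hh⟩ := hex.choice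
  have hlim : Tendsto h atTop (𝓝 c) := by
    rw [tendsto_iff_norm_sub_tendsto_zero]
    exact squeeze_zero' (Eventually.of_forall fun _ => norm_nonneg _)
      (hh.mono fun N hN => hN.1) hη
  have hS := tendsto_prod_sineZero hL.ne' z
  have hlim2 := (((hS.pow m).const_mul (f z)).div (hlim.mul_const (sin (z * L) ^ m))
    (mul_ne_zero hc (pow_ne_zero _ hz)))
  have e : f z * (-sin (z * L)) ^ m / (c * sin (z * L) ^ m) = (-1) ^ m * f z / c := by
    rw [neg_pow]
    field_simp
  rw [e] at hlim2
  refine hlim2.congr' ?_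
  filter_upwards [hh, hlim.eventually_ne hc] with N hN hN0
  have hpiprod : ∏ j ∈ Finset.Icc (-(N : ℤ)) N, piNorm L j ≠ 0 :=
    Finset.prod_ne_zero_iff.2 fun j _ => piNorm_ne_zero hL.ne' j
  simp only [Pi.div_apply, Finset.prod_div_distrib, Finset.prod_const, Finset.card_univ, ← hm, Finset.prod_pow]
  rw [div_eq_div_iff (mul_ne_zero hN0 (pow_ne_zero _ hz)) (pow_ne_zero _ hpiprod), div_pow,
    ← mul_div_assoc, ← hN.2]
  field_simp

end

/-! ### Location of the zeros and conditionally convergent products. -/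

section

/-- The Taylor remainder gives |sin w - w| ≤ |w|² ≤ (4/5)|w|. The radius 4/5 is used because it
exceeds π/4. -/
theorem norm_le_five_mul_norm_sin {w : ℂ} (hw : ‖w‖ ≤ 4 / 5) : ‖w‖ ≤ 5 * ‖sin w‖ := by
  have e : sin w - w = I / 2 * ((exp (-w * I) - 1 - (-w * I)) - (exp (w * I) - 1 - w * I)) := by
    have hI : I ^ 2 = -1 := I_sq
    rw [Complex.sin]
    linear_combination (-w) * hI
  have n1 := Complex.norm_exp_sub_one_sub_id_le (x := -w * I) (by simp; linarith)
  have n2 := Complex.norm_exp_sub_one_sub_id_le (x := w * I) (by simp; linarith)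
  simp only [norm_mul, norm_neg, norm_I, mul_one] at n1 n2
  have h1 : ‖sin w - w‖ ≤ ‖w‖ ^ 2 := by
    rw [e, norm_mul, norm_div, norm_I, RCLike.norm_ofNat]
    have := norm_sub_le (exp (-w * I) - 1 - (-w * I)) (exp (w * I) - 1 - w * I)
    linarith
  have h2 := norm_sub_norm_le w (sin w)
  rw [norm_sub_rev] at h2
  nlinarith [norm_nonneg w]

variable {L : ℝ}

/-- Zeros which are labelled like those of the sine function are asymptotically close to these. -/
theorem exists_zero_asymptotics (hL : 0 < L) {f : ℂ → ℂ} {m : ℕ} (hm : m ≤ 2) {c : ℂ} (hc : c ≠ 0)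
    {K : ℝ} (hK : 0 ≤ K) (hasym : ∀ z : ℂ, z ≠ 0 →
      ‖f z - c * sin (z * L) ^ m‖ ≤ K * Real.exp (|z.im| * L) ^ m / ‖z‖)
    {a : ℤ → ℂ} (hfa : ∀ j, f (a j) = 0)
    (ha : ∀ᶠ j : ℤ in cofinite, ‖a j - sineZero L j‖ < Real.pi / (4 * L)) :
    ∃ C : ℝ, 0 ≤ C ∧ ∀ j, ‖a j - sineZero L j‖ ≤ C / √((j.natAbs : ℝ) + 1) := by
  set κ := Real.pi / L with hκ
  have hκ0 : 0 < κ := div_pos Real.pi_pos hL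
  have hκL : κ * L = Real.pi := div_mul_cancel₀ _ hL.ne'
  set A := 8 * K * Real.exp 1 ^ m / (3 * κ * ‖c‖) with hA
  have hc0 : 0 < ‖c‖ := norm_pos_iff.2 hc
  have hbig : (fun j => a j - sineZero L j) =O[cofinite]
      fun j : ℤ => 1 / √((j.natAbs : ℝ) + 1) := by
    refine Asymptotics.IsBigO.of_bound (5 * √A / L) ?_
    filter_upwards [ha, (Set.finite_singleton (0 : ℤ)).compl_mem_cofinite] with j hj hj0
    have hj1 : (1 : ℝ) ≤ j.natAbs := by
      exact_mod_cast Nat.one_le_iff_ne_zero.2 (Int.natAbs_ne_zero.2 hj0)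
    set w := (a j - sineZero L j) * L with hw
    have hwn : ‖w‖ = ‖a j - sineZero L j‖ * L := by
      rw [hw, norm_mul, Complex.norm_real, Real.norm_of_nonneg hL.le]
    have hwpi : ‖w‖ ≤ Real.pi / 4 := by
      rw [hwn]
      calc _ ≤ Real.pi / (4 * L) * L := by gcongr
        _ = _ := by field_simp
    have hpi4 : Real.pi / 4 ≤ 4 / 5 := by linarith [Real.pi_lt_d2]
    have hsw : ‖sin w‖ = ‖sin (a j * L)‖ := by
      have hLc : (L : ℂ) ≠ 0 := by exact_mod_cast hL.ne'
      have e : w = a j * L - j * Real.pi := by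
        rw [hw, sineZero]
        push_cast
        field_simp
      rw [e, Complex.sin_antiperiodic.sub_int_mul_eq, norm_mul]
      simp
    have hw5 := norm_le_five_mul_norm_sin (hwpi.trans hpi4)
    rw [hsw] at hw5
    have him : |(a j).im| * L ≤ 1 := by
      have h1 := Complex.abs_im_le_norm w
      have h2 : w.im = (a j).im * L := by simp [hw, sineZero]
      rw [h2, abs_mul, abs_of_pos hL] at h1
      linarith
    have hsz : ‖sineZero L j‖ = κ * j.natAbs := by
      rw [sineZero, Complex.norm_real, Real.norm_eq_abs, mul_comm, mul_div_assoc, abs_mul, ← hκ,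
        abs_of_pos hκ0, Nat.cast_natAbs, Int.cast_abs, mul_comm]
    -- From |a_j| ≥ κ(|j| - 1/4); the constant 3/8 is sharp for this comparison at |j| = 1.
    have han : 3 / 8 * κ * ((j.natAbs : ℝ) + 1) ≤ ‖a j‖ := by
      have h1 := norm_sub_norm_le (sineZero L j) (a j)
      rw [norm_sub_rev, hsz] at h1
      have h2 : Real.pi / (4 * L) = κ / 4 := by rw [hκ]; field_simp
      rw [h2] at hj
      nlinarith
    have ha0 : a j ≠ 0 := norm_pos_iff.1 (lt_of_lt_of_le (by positivity) han)
    have h1 := hasym (a j) ha0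
    rw [hfa, zero_sub, norm_neg, norm_mul, norm_pow] at h1
    have h2 : ‖c‖ * ‖sin (a j * L)‖ ^ m ≤ K * Real.exp 1 ^ m / (3 / 8 * κ * (j.natAbs + 1)) :=
      h1.trans (by gcongr)
    have h3 : ‖sin (a j * L)‖ ^ m ≤ A / (j.natAbs + 1) := by
      rw [← mul_le_mul_iff_right₀ hc0]
      refine h2.trans_eq ?_
      rw [hA]
      field_simp
    -- Since m ≤ 2 and the base is at most 1, the square serves both functions. It costs a square
    -- root, hence the rate |j|^(-1/2), which is still enough.
    have h4 : (‖w‖ / 5) ^ 2 ≤ A / (j.natAbs + 1) := by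
      calc (‖w‖ / 5) ^ 2 ≤ (‖w‖ / 5) ^ m :=
            pow_le_pow_of_le_one (by positivity) (by linarith) hm
        _ ≤ ‖sin (a j * L)‖ ^ m := by gcongr; linarith
        _ ≤ _ := h3
    have h5 := Real.le_sqrt_of_sq_le h4
    rw [Real.sqrt_div (by positivity)] at h5
    have h6 : ‖a j - sineZero L j‖ = ‖w‖ / L := by rw [hwn]; field_simp
    rw [h6, Real.norm_of_nonneg (by positivity)]
    calc ‖w‖ / L = 5 * (‖w‖ / 5) / L := by ring
      _ ≤ 5 * (√A / √(j.natAbs + 1)) / L := by gcongr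
      _ = _ := by ring
  obtain ⟨C, hC, hb⟩ := Asymptotics.bound_of_isBigO_cofinite hbig
  refine ⟨C, hC.le, fun j => ?_⟩
  have hpos : 0 < √((j.natAbs : ℝ) + 1) := Real.sqrt_pos.2 (by positivity)
  have := hb (x := j) (one_div_pos.2 hpos).ne'
  rwa [Real.norm_of_nonneg (by positivity), mul_one_div] at this

/-- The sequence `f` is `1 + α / j + O(|j| ^ (-3/2))`. -/
def NearOne (α : ℂ) (f : ℤ → ℂ) : Prop :=
  (fun j => f j - 1 - α / j) =O[cofinite] fun j : ℤ => |(j : ℝ)| ^ (-(3 / 2) : ℝ)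

theorem eventually_one_le_abs : ∀ᶠ j : ℤ in cofinite, 1 ≤ |(j : ℝ)| := by
  filter_upwards [(Set.finite_singleton (0 : ℤ)).compl_mem_cofinite] with j hj
  exact_mod_cast Int.one_le_abs hj

theorem isBigO_inv_sq : (fun j : ℤ => ((j : ℂ) ^ 2)⁻¹) =O[cofinite]
    fun j : ℤ => |(j : ℝ)| ^ (-(3 / 2) : ℝ) := by
  refine Asymptotics.IsBigO.of_bound 1 ?_
  filter_upwards [eventually_one_le_abs] with j hj
  rw [norm_inv, norm_pow, Complex.norm_intCast, one_mul, Real.norm_of_nonneg (by positivity),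
    ← Real.rpow_natCast, ← Real.rpow_neg (abs_nonneg _)]
  exact Real.rpow_le_rpow_of_exponent_le hj (by norm_num)

theorem tendsto_const_div_int (α : ℂ) : Tendsto (fun j : ℤ => α / j) cofinite (𝓝 0) := by
  have h1 : Tendsto (fun j : ℤ => ‖(j : ℂ)‖) cofinite atTop := by
    simp only [Complex.norm_intCast]
    exact (tendsto_norm_cocompact_atTop (E := ℝ)).comp Int.tendsto_coe_cofinite
  rw [tendsto_zero_iff_norm_tendsto_zero]
  simp only [norm_div]
  exact tendsto_const_nhds.div_atTop h1

theorem tendsto_weight :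
    Tendsto (fun j : ℤ => |(j : ℝ)| ^ (-(3 / 2) : ℝ)) cofinite (𝓝 0) :=
  (Real.summable_abs_int_rpow (by norm_num : (1 : ℝ) < 3 / 2)).tendsto_cofinite_zero

namespace NearOne

variable {α β : ℂ} {f g : ℤ → ℂ}

theorem tendsto_one (hf : NearOne α f) : Tendsto f cofinite (𝓝 1) := by
  have h1 := ((hf.trans_tendsto tendsto_weight).add (tendsto_const_div_int α)).add_const 1
  simpa using h1

theorem mul (hf : NearOne α f) (hg : NearOne β g) : NearOne (α + β) fun j => f j * g j := by
  have hg1 : g =O[cofinite] fun _ => (1 : ℝ) := hg.tendsto_one.isBigO_one ℝ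
  have hα1 : (fun j : ℤ => 1 + α / j) =O[cofinite] fun _ => (1 : ℝ) :=
    ((tendsto_const_div_int α).const_add 1).isBigO_one ℝ
  have h1 := Asymptotics.IsBigO.mul hf hg1
  have h2 := Asymptotics.IsBigO.mul hα1 hg
  simp only [mul_one, one_mul] at h1 h2
  refine ((h1.add h2).add (isBigO_inv_sq.const_mul_left (α * β))).congr_left fun j => ?_
  simp only [div_eq_mul_inv]
  ring

theorem inv (hf : NearOne α f) : NearOne (-α) fun j => (f j)⁻¹ := by
  have hf1 : (fun j => (f j)⁻¹) =O[cofinite] fun _ => (1 : ℝ) :=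
    (hf.tendsto_one.inv₀ one_ne_zero).isBigO_one ℝ
  have hα1 : (fun j : ℤ => α / j) =O[cofinite] fun _ => (1 : ℝ) :=
    (tendsto_const_div_int α).isBigO_one ℝ
  have h1 := Asymptotics.IsBigO.mul hα1 hf
  simp only [one_mul] at h1
  have h2 := Asymptotics.IsBigO.mul (((isBigO_inv_sq.const_mul_left (α ^ 2)).add h1).sub hf) hf1
  simp only [mul_one] at h2
  refine h2.congr' ?_ EventuallyEq.rfl
  filter_upwards [hf.tendsto_one.eventually_ne one_ne_zero] with j hj
  simp only [div_eq_mul_inv, ← inv_pow]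
  linear_combination (α * (j : ℂ)⁻¹ - 1) * mul_inv_cancel₀ hj

theorem exp_div (α : ℂ) : NearOne α fun j => exp (α / j) := by
  refine Asymptotics.IsBigO.trans ?_ (isBigO_inv_sq.const_mul_left (α ^ 2))
  refine Asymptotics.IsBigO.of_bound 1 ?_
  filter_upwards [(tendsto_const_div_int α).eventually (Metric.closedBall_mem_nhds 0 one_pos)]
    with j hj
  replace hj : ‖α / j‖ ≤ 1 := by simpa using hj
  refine (Complex.norm_exp_sub_one_sub_id_le hj).trans_eq ?_
  rw [one_mul, ← norm_pow, div_pow, div_eq_mul_inv]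

open Classical in
/-- Convergence of products over a set `A` of labels on which the sums of `1 / j` converge. -/
theorem exists_tendsto_prod (hf : NearOne α f) (A : ℤ → Prop) {l : ℝ}
    (hA : Tendsto (fun N : ℕ => ∑ j ∈ (Finset.Icc (-(N : ℤ)) N).filter A, ((j : ℝ))⁻¹) atTop
      (𝓝 l)) :
    ∃ p, Tendsto (fun N : ℕ => ∏ j ∈ (Finset.Icc (-(N : ℤ)) N).filter A, f j) atTop (𝓝 p) := by
  -- The convergence factor e^{-α/j} removes the 1/j term and makes the product absolutely
  -- convergent; what was inserted is restored as the exponential of α times the sum of 1/j. At j =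
  -- 0 both conventions give the value 0 in the exponent.
  set g : ℤ → ℂ := fun j => if A j then f j * exp (-α / j) - 1 else 0 with hg
  have hgO : g =O[cofinite] fun j : ℤ => |(j : ℝ)| ^ (-(3 / 2) : ℝ) := by
    refine Asymptotics.IsBigO.trans (Asymptotics.IsBigO.of_bound 1 (Eventually.of_forall
      fun j => ?_)) (show _ =O[cofinite] _ from hf.mul (exp_div (-α)))
    simp only [hg]
    split_ifs <;> simp
  have hsum : Summable fun j => ‖g j‖ :=
    summable_of_isBigO (Real.summable_abs_int_rpow (by norm_num : (1 : ℝ) < 3 / 2)) hgO.norm_left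
  have hprod := (multipliable_one_add_of_summable hsum).hasProd.comp (Finset.tendsto_Icc_neg (R := ℤ))
  have hexp : Tendsto (fun N : ℕ => exp (α *
      ((∑ j ∈ (Finset.Icc (-(N : ℤ)) N).filter A, ((j : ℝ))⁻¹ : ℝ) : ℂ))) atTop
      (𝓝 (exp (α * l))) :=
    (((Complex.continuous_ofReal.tendsto l).comp hA).const_mul α).cexp
  refine ⟨_, (hprod.mul hexp).congr fun N => ?_⟩
  simp only [Function.comp_apply]
  push_cast
  rw [Finset.mul_sum, Complex.exp_sum, Finset.prod_filter, Finset.prod_filter,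
    ← Finset.prod_mul_distrib]
  refine Finset.prod_congr rfl fun j _ => ?_
  simp only [hg]
  split_ifs
  · rw [add_sub_cancel, mul_assoc, ← Complex.exp_add, div_eq_mul_inv, neg_mul, neg_add_cancel,
      Complex.exp_zero, mul_one]
  · simp

end NearOne

/-- After removing 1 - zL/(πj), the remainder is exactly the displacement of the zero divided by
jπ/L, that is O(|j|^(-1/2)) times O(1/|j|). -/
theorem nearOne_factor (hL : 0 < L) {a : ℤ → ℂ} {C : ℝ} (hC : 0 ≤ C)
    (ha : ∀ j, ‖a j - sineZero L j‖ ≤ C / √((j.natAbs : ℝ) + 1)) (z : ℂ) :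
    NearOne (-(z * L / Real.pi)) fun j => (a j - z) / piNorm L j := by
  have hLc : (L : ℂ) ≠ 0 := by exact_mod_cast hL.ne'
  have hpi : (Real.pi : ℂ) ≠ 0 := by exact_mod_cast Real.pi_ne_zero
  refine Asymptotics.IsBigO.of_bound (C * L / Real.pi) ?_
  filter_upwards [eventually_one_le_abs] with j hj
  have hj0 : j ≠ 0 := by
    rintro rfl
    norm_num at hj
  have hjc : (j : ℂ) ≠ 0 := by exact_mod_cast hj0
  have hP : piNorm L j = sineZero L j := by rw [piNorm, if_neg hj0, sineZero]
  have hP0 : sineZero L j ≠ 0 := hP ▸ piNorm_ne_zero hL.ne' j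
  have e : (a j - z) / piNorm L j - 1 - -(z * L / Real.pi) / j =
      (a j - sineZero L j) / sineZero L j := by
    have h1 : z * L / Real.pi / j = z / sineZero L j := by
      rw [sineZero]
      push_cast
      field_simp
    rw [hP, neg_div, h1]
    field_simp
    ring
  have hsz : ‖sineZero L j‖ = Real.pi * |(j : ℝ)| / L := by
    rw [sineZero, Complex.norm_real, Real.norm_eq_abs, abs_div, abs_mul, abs_of_pos hL,
      abs_of_pos Real.pi_pos]
  have hj1 : 0 < |(j : ℝ)| := by linarith
  have h2 : |(j : ℝ)| ^ (-(3 / 2) : ℝ) = 1 / (√|(j : ℝ)| * |(j : ℝ)|) := by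
    rw [Real.sqrt_eq_rpow, ← Real.rpow_add_one hj1.ne', one_div, ← Real.rpow_neg hj1.le]
    norm_num
  have h3 := ha j
  rw [Nat.cast_natAbs, Int.cast_abs] at h3
  rw [e, norm_div, hsz, h2, Real.norm_of_nonneg (by positivity)]
  have h4 : 0 < √|(j : ℝ)| := Real.sqrt_pos.2 hj1
  calc _ ≤ (C / √|(j : ℝ)|) / (Real.pi * |(j : ℝ)| / L) := by
        gcongr
        refine h3.trans ?_
        gcongr
        linarith
    _ = _ := by field_simp

end

/-! ### Product representations for the two spectra. -/

theorem EnumeratesZeros.apply_eq_zero {f : ℂ → ℂ} {a : ℤ → ℂ} (h : EnumeratesZeros f a) (j : ℤ) :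
    f (a j) = 0 := by
  refine apply_eq_zero_of_analyticOrderAt_ne_zero fun h0 => ?_
  have h1 := h (a j)
  rw [h0, Set.encard_eq_zero] at h1
  have : j ∈ ({i : ℤ | a i = a j} : Set ℤ) := rfl
  rw [h1] at this
  exact this

theorem EnumeratesZeros.encard_le {ι : Type*} {f : ℂ → ℂ} {a : ℤ → ℂ} (h : EnumeratesZeros f a)
    {e : ι → ℤ} (he : Function.Injective e) (w : ℂ) :
    ({p | a (e p) = w} : Set ι).encard ≤ analyticOrderAt f w := by
  rw [← h w, ← he.encard_image]
  refine Set.encard_le_encard ?_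
  rintro _ ⟨p, hp, rfl⟩
  exact hp

/-- Needed to pass from a set of labels to its complement: over all labels the symmetric sums
cancel. -/
theorem sum_Icc_neg_inv (N : ℕ) : ∑ j ∈ Finset.Icc (-(N : ℤ)) N, ((j : ℝ))⁻¹ = 0 := by
  have h : ∑ j ∈ Finset.Icc (-(N : ℤ)) N, ((j : ℝ))⁻¹ =
      ∑ j ∈ Finset.Icc (-(N : ℤ)) N, -((j : ℝ))⁻¹ := by
    refine Finset.sum_equiv (Equiv.neg ℤ) (fun j => ?_) (fun j _ => ?_)
    · simp only [Equiv.neg_apply, Finset.mem_Icc]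
      omega
    · simp [inv_neg]
  rw [Finset.sum_neg_distrib] at h
  linarith

namespace FloquetData

variable {L : ℝ} (D : FloquetData L)

theorem mem_spectrum_of_im_eq_zero {z : ℂ} (hz : z.im = 0) : z ∈ D.spectrum :=
  D.principal.mem_laxSpectrum_of_im_eq_zero hz

variable {D} in
theorem discriminant_sq_sub_one_ne_zero (hL : 0 < L) {z : ℂ} (hz : z ∉ D.spectrum) :
    discriminant L D.Y z ^ 2 - 1 ≠ 0 :=
  fun h => hz (D.principal.mem_laxSpectrum_of_discriminant hL D.periodic h)

variable {D} in
theorem zeta_sub_ne_zero (hL : 0 < L) {z : ℂ} (hz : z ∉ D.spectrum) (j : ℤ) :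
    D.zeta j - z ≠ 0 := fun h =>
  discriminant_sq_sub_one_ne_zero hL hz (sub_eq_zero.1 h ▸ D.zeta_enum.apply_eq_zero j)

variable {D} in
theorem sin_ne_zero (hL : 0 < L) {z : ℂ} (hz : z ∉ D.spectrum) : sin (z * L) ≠ 0 := by
  intro h
  obtain ⟨k, hk⟩ := Complex.sin_eq_zero_iff.1 h
  apply hz (D.mem_spectrum_of_im_eq_zero _)
  have := congrArg Complex.im hk
  simpa [hL.ne'] using this

theorem exists_mu_asymptotics (hL : 0 < L) :
    ∃ C : ℝ, 0 ≤ C ∧ ∀ j, ‖D.mu j - sineZero L j‖ ≤ C / √((j.natAbs : ℝ) + 1) := by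
  obtain ⟨K, hK⟩ := D.exists_y12_asymptotics hL
  refine exists_zero_asymptotics hL (f := D.y12) (m := 1) (by norm_num) one_ne_zero (le_max_right K 0)
    (fun z hz => ?_) D.mu_enum.apply_eq_zero D.mu_disc
  rw [pow_one, one_mul, pow_one]
  refine (hK z hz).trans ?_
  gcongr
  exact le_max_left _ _

/-- The pairs of main eigenvalues. -/
def zetaPair (i : Bool) (j : ℤ) : ℂ := D.zeta (if i then 2 * j else 2 * j - 1)

theorem exists_zetaPair_asymptotics (hL : 0 < L) :
    ∃ C : ℝ, 0 ≤ C ∧ ∀ i j, ‖D.zetaPair i j - sineZero L j‖ ≤ C / √((j.natAbs : ℝ) + 1) := by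
  obtain ⟨K, hK⟩ := D.exists_discriminant_asymptotics hL
  obtain ⟨C, hC, h⟩ := exists_zero_asymptotics hL (m := 2) le_rfl
    (neg_ne_zero.2 (one_ne_zero (α := ℂ))) (le_max_right K 0)
    (fun z hz => by
      rw [neg_one_mul, sub_neg_eq_add]
      refine (hK z hz).trans ?_
      gcongr
      exact le_max_left _ _)
    (a := fun j => D.zeta (2 * j)) (fun j => D.zeta_enum.apply_eq_zero _) D.zeta_disc
  refine ⟨C, hC, fun i j => ?_⟩
  cases i
  -- The odd-indexed eigenvalue is the conjugate of its partner and jπ/L is real, so the two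
  -- displacements have equal norm.
  · have e : D.zetaPair false j - sineZero L j =
        (starRingEnd ℂ) (D.zeta (2 * j) - sineZero L j) := by
      simp [zetaPair, D.zeta_conj, sineZero]
    rw [e, RCLike.norm_conj]
    exact h j
  · exact h j

variable {D} in
/-- Product representation of `ỹ₁₂`. -/
theorem tendsto_prod_mu (hL : 0 < L) {z : ℂ} (hz : z ∉ D.spectrum) :
    Tendsto (fun N : ℕ => ∏ j ∈ Finset.Icc (-(N : ℤ)) N, (D.mu j - z) / piNorm L j) atTop
      (𝓝 (-D.y12 z)) := by
  obtain ⟨C, hC, h⟩ := D.exists_mu_asymptotics hL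
  obtain ⟨K, hK⟩ := D.exists_y12_asymptotics hL
  have := tendsto_canonicalProduct (ι := Unit) hL (D.differentiable_y12 hL) (fun _ => D.mu)
    (fun w => D.mu_enum.encard_le (e := Prod.snd) (fun p p' h => Prod.ext rfl h) w) hC
    (fun _ => h) one_ne_zero (le_max_right K 0) (fun z hz => by
      rw [Fintype.card_unit, pow_one, one_mul, pow_one]
      refine (hK z hz).trans ?_
      gcongr
      exact le_max_left _ _) (sin_ne_zero hL hz)
  simpa using this

variable {D} in
/-- Product representation of `Δ² - 1`. -/
theorem tendsto_prod_zeta (hL : 0 < L) {z : ℂ} (hz : z ∉ D.spectrum) :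
    Tendsto (fun N : ℕ => ∏ j ∈ Finset.Icc (-(N : ℤ)) N,
        ((D.zeta (2 * j) - z) / piNorm L j * ((D.zeta (2 * j - 1) - z) / piNorm L j))) atTop
      (𝓝 (-(discriminant L D.Y z ^ 2 - 1))) := by
  obtain ⟨C, hC, h⟩ := D.exists_zetaPair_asymptotics hL
  obtain ⟨K, hK⟩ := D.exists_discriminant_asymptotics hL
  have := tendsto_canonicalProduct hL (((D.differentiable_discriminant hL).fun_pow 2).sub_const 1)
    D.zetaPair (fun w => D.zeta_enum.encard_le
      (e := fun p : Bool × ℤ => if p.1 then 2 * p.2 else 2 * p.2 - 1) (by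
        rintro ⟨i, j⟩ ⟨i', j'⟩ h
        cases i <;> cases i' <;> simp at h ⊢ <;> omega) w) hC
    h (neg_ne_zero.2 (one_ne_zero (α := ℂ))) (le_max_right K 0) (fun z hz => by
      rw [Fintype.card_bool, neg_one_mul, sub_neg_eq_add]
      refine (hK z hz).trans ?_
      gcongr
      exact le_max_left _ _) (sin_ne_zero hL hz)
  have e : (-1) ^ Fintype.card Bool * (discriminant L D.Y z ^ 2 - 1) / -1 =
      -(discriminant L D.Y z ^ 2 - 1) := by rw [Fintype.card_bool]; ring
  rw [e] at this
  simpa only [Fintype.prod_bool, zetaPair, if_true, Bool.false_eq_true, if_false] using this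

theorem nearOne_mu (hL : 0 < L) (z : ℂ) :
    NearOne (-(z * L / Real.pi)) fun j => (D.mu j - z) / piNorm L j := by
  obtain ⟨C, hC, h⟩ := D.exists_mu_asymptotics hL
  exact nearOne_factor hL hC h z

theorem nearOne_zetaPair (hL : 0 < L) (z : ℂ) (i : Bool) :
    NearOne (-(z * L / Real.pi)) fun j => (D.zetaPair i j - z) / piNorm L j := by
  obtain ⟨C, hC, h⟩ := D.exists_zetaPair_asymptotics hL
  exact nearOne_factor hL hC (h i) z

/-! ### Signs of the Dirichlet eigenvalues. -/

theorem nu_mem (k : ℤ) : D.nu k = 0 ∨ D.nu k = 1 ∨ D.nu k = -1 := by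
  rw [nu]
  split_ifs
  · simp
  · simp
  · rcases lt_trichotomy (Real.log ‖D.y22 (D.mu k)‖) 0 with h | h | h
    · simp [sign_neg h]
    · simp [h]
    · simp [sign_pos h]

/-- The modified monodromy matrix has determinant `1`; at a Dirichlet eigenvalue it is triangular
with diagonal entries `ỹ₂₂` and `2 Δ - ỹ₂₂`. -/
theorem y22_mul_eq_one (k : ℤ) :
    D.y22 (D.mu k) * (2 * discriminant L D.Y (D.mu k) - D.y22 (D.mu k)) = 1 := by
  have h0 : D.y12 (D.mu k) = 0 := D.mu_enum.apply_eq_zero k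
  have hdet := D.principal.det_eq_one L (D.mu k)
  rw [y12_eq, mul_eq_zero] at h0
  have h1 := h0.resolve_left (by simp)
  rw [y22_eq, discriminant_eq]
  linear_combination hdet + (D.Y L (D.mu k) 0 0 + D.Y L (D.mu k) 0 1 - D.Y L (D.mu k) 1 0 -
    D.Y L (D.mu k) 1 1) / 4 * h1

/-- Triangularity gives ỹ₂₂² = 1, so the logarithm in the definition of ν vanishes; membership among
the main eigenvalues rules out the other branch of that definition. -/
theorem nu_eq_zero_of_y22 {k : ℤ} (hk : D.mu k ∈ Set.range D.zeta)
    (h : D.y22 (D.mu k) = discriminant L D.Y (D.mu k)) : D.nu k = 0 := by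
  have h1 := D.y22_mul_eq_one k
  have h2 : D.y22 (D.mu k) ^ 2 = 1 := by rw [← h] at h1; linear_combination h1
  have h3 : ‖D.y22 (D.mu k)‖ = 1 := by
    have := congrArg norm h2
    rw [norm_pow, norm_one] at this
    exact (pow_eq_one_iff_of_nonneg (norm_nonneg _) two_ne_zero).1 this
  rw [nu, if_neg fun h => h.2 hk, h3]
  simp

/-- At a Dirichlet eigenvalue (ỹ₂₂ - Δ)² = Δ² - 1, which vanishes here. This is why degenerate
labels can be omitted from the spectral data. -/
theorem nu_eq_zero_of_degenerate {k : ℤ} (hk : D.zeta (2 * k) = D.zeta (2 * k - 1)) :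
    D.nu k = 0 := by
  have hmu := D.mu_degenerate k hk
  refine D.nu_eq_zero_of_y22 ⟨2 * k, hmu.symm⟩ ?_
  have h1 := D.y22_mul_eq_one k
  have h2 : discriminant L D.Y (D.mu k) ^ 2 - 1 = 0 := by
    rw [hmu]
    exact D.zeta_enum.apply_eq_zero (2 * k)
  rw [← sub_eq_zero, ← sq_eq_zero_iff]
  linear_combination h2 - h1

/-- For a real even potential all the signs vanish. -/
theorem nu_eq_zero_of_real_even (hreal : ∀ x, (D.q x).im = 0) (heven : ∀ x, D.q (-x) = D.q x)
    (hL : 0 < L) (k : ℤ) : D.nu k = 0 := by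
  have h0 := D.principal.offDiag_add_eq_zero D.periodic hreal heven (D.mu k)
  have h : D.y22 (D.mu k) = discriminant L D.Y (D.mu k) := by
    rw [y22_eq, discriminant_eq]
    linear_combination (-1 / 2 : ℂ) * h0
  refine D.nu_eq_zero_of_y22 ?_ h
  have h1 := D.y22_mul_eq_one k
  -- With ỹ₂₂ = Δ, the determinant relation says Δ² = 1, so the Dirichlet eigenvalue occurs in the
  -- list of main eigenvalues.
  have hz : discriminant L D.Y (D.mu k) ^ 2 - 1 = 0 := by
    rw [h] at h1
    linear_combination h1
  have hord := D.zeta_enum (D.mu k)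
  have hd : Differentiable ℂ fun z => discriminant L D.Y z ^ 2 - 1 :=
    ((D.differentiable_discriminant hL).fun_pow 2).sub_const 1
  have hne := analyticOrderAt_ne_zero.2 ⟨hd.analyticAt (D.mu k), hz⟩
  rw [← hord, Set.encard_ne_zero] at hne
  exact hne

/-! ### Products over sign classes and the matrix B. -/

variable {D} in
-- The class ν ≠ 0 is the disjoint union of the classes ±1, and the class ν = 0 is its complement,
-- for which the symmetric sums are the negatives.
theorem BalancedSigns.exists_tendsto (hB : D.BalancedSigns) (A : ℤ → Prop) [DecidablePred A]
    (hA : A = (fun j => D.nu j = 1) ∨ A = (fun j => D.nu j = -1) ∨ A = (fun j => D.nu j = 0) ∨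
      A = fun j => D.nu j ≠ 0) :
    ∃ l : ℝ, Tendsto (fun N : ℕ => ∑ j ∈ (Finset.Icc (-(N : ℤ)) N).filter A, ((j : ℝ))⁻¹) atTop
      (𝓝 l) := by
  obtain ⟨l₁, h1⟩ := hB 1 (Or.inl rfl)
  obtain ⟨l₂, h2⟩ := hB (-1) (Or.inr rfl)
  have hsplit : ∀ N : ℕ, ∑ j ∈ (Finset.Icc (-(N : ℤ)) N).filter (fun j => D.nu j ≠ 0),
      ((j : ℝ))⁻¹ = ∑ j ∈ (Finset.Icc (-(N : ℤ)) N).filter (fun j => D.nu j = 1), ((j : ℝ))⁻¹ +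
        ∑ j ∈ (Finset.Icc (-(N : ℤ)) N).filter (fun j => D.nu j = -1), ((j : ℝ))⁻¹ := by
    intro N
    simp only [Finset.sum_filter]
    rw [← Finset.sum_add_distrib]
    refine Finset.sum_congr rfl fun j _ => ?_
    rcases D.nu_mem j with h | h | h <;> simp [h]
  have hne := (h1.add h2).congr fun N => (hsplit N).symm
  rcases hA with rfl | rfl | rfl | rfl
  · exact ⟨l₁, by convert h1⟩
  · exact ⟨l₂, by convert h2⟩
  · refine ⟨_, hne.neg.congr fun N => ?_⟩
    have h3 := Finset.sum_filter_add_sum_filter_not (Finset.Icc (-(N : ℤ)) N)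
      (fun j => D.nu j = 0) (fun j => ((j : ℝ))⁻¹)
    rw [sum_Icc_neg_inv] at h3
    rw [neg_eq_iff_add_eq_zero, add_comm]
    convert h3
  · exact ⟨_, by convert hne⟩

variable {D} in
theorem BalancedSigns.tendsto_dirichletPartial (hB : D.BalancedSigns) (hL : 0 < L) (ε : ℤ)
    (z : ℂ) : Tendsto (D.dirichletPartial ε z) atTop (𝓝 (D.dirichletProd ε z)) := by
  refine tendsto_nhds_limUnder ?_
  by_cases hε : ε = 1 ∨ ε = -1 ∨ ε = 0
  · obtain ⟨l, hl⟩ := hB.exists_tendsto (fun j => D.nu j = ε)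
      (by rcases hε with rfl | rfl | rfl <;> simp)
    obtain ⟨p, hp⟩ := (D.nearOne_mu hL z).exists_tendsto_prod _ (by convert hl)
    refine ⟨p, hp.congr fun N => ?_⟩
    rw [dirichletPartial]
    congr
  -- No label carries any other value of the sign, so these products are empty.
  · refine ⟨1, tendsto_const_nhds.congr fun N => ?_⟩
    rw [dirichletPartial, Finset.filter_false_of_mem, Finset.prod_empty]
    intro j _ h
    have := D.nu_mem j
    rw [h] at this
    tauto

theorem partialProd_fFactor {ε : ℤ} (hε : ε ≠ 0) (z : ℂ) (N : ℕ) :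
    D.spectralData.partialProd (D.spectralData.fFactor L ε z) N = D.dirichletPartial ε z N := by
  rw [SpectralData.partialProd, dirichletPartial, Finset.prod_filter]
  refine Finset.prod_congr rfl fun j _ => ?_
  by_cases hj : D.zeta (2 * j) = D.zeta (2 * j - 1)
  · have hnu := D.nu_eq_zero_of_degenerate hj
    rw [dif_neg (fun h => h hj), if_neg (by rw [hnu]; exact hε.symm)]
  · rw [dif_pos (show j ∈ D.spectralData.idx from hj)]
    rfl

variable {D} in
-- A degenerate label contributes 1 because numerator and denominator coincide. That they are
-- nonzero, so that the quotient is not the default value 0, uses z off the Lax spectrum.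
theorem partialProd_bFactorZero (hL : 0 < L) {z : ℂ} (hz : z ∉ D.spectrum) (N : ℕ) :
    D.spectralData.partialProd (D.spectralData.bFactorZero z) N =
      ∏ j ∈ (Finset.Icc (-(N : ℤ)) N).filter (fun j => D.nu j = 0),
        (D.mu j - z) ^ 2 / ((D.zeta (2 * j) - z) * (D.zeta (2 * j - 1) - z)) := by
  rw [SpectralData.partialProd, Finset.prod_filter]
  refine Finset.prod_congr rfl fun j _ => ?_
  by_cases hj : D.zeta (2 * j) = D.zeta (2 * j - 1)
  · have hnu := D.nu_eq_zero_of_degenerate hj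
    have hne := zeta_sub_ne_zero hL hz (2 * j - 1)
    rw [dif_neg (fun h => h hj), if_pos hnu, D.mu_degenerate j hj, hj, ← sq,
      div_self (pow_ne_zero _ hne)]
  · rw [dif_pos (show j ∈ D.spectralData.idx from hj)]
    rfl

theorem partialProd_bFactorNonzero (z : ℂ) (N : ℕ) :
    D.spectralData.partialProd (D.spectralData.bFactorNonzero L z) N =
      ∏ j ∈ (Finset.Icc (-(N : ℤ)) N).filter (fun j => D.nu j ≠ 0),
        piNorm L j ^ 2 / ((D.zeta (2 * j) - z) * (D.zeta (2 * j - 1) - z)) := by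
  rw [SpectralData.partialProd, Finset.prod_filter]
  refine Finset.prod_congr rfl fun j _ => ?_
  by_cases hj : D.zeta (2 * j) = D.zeta (2 * j - 1)
  · have hnu := D.nu_eq_zero_of_degenerate hj
    rw [dif_neg (fun h => h hj), if_neg (by simp [hnu])]
  · rw [dif_pos (show j ∈ D.spectralData.idx from hj)]
    rfl

variable {D} in
/-- The product formula for `b⁴`. -/
theorem BalancedSigns.exists_prod_eq (hB : D.BalancedSigns) (hL : 0 < L) {s t : ℂ → ℂ}
    (hs : D.IsRootF0 s) (ht : D.IsFourthRoot t) {z : ℂ} (hz : z ∉ D.spectrum) :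
    ∃ p₀ p₁ : ℂ,
      Tendsto (D.spectralData.partialProd (D.spectralData.bFactorZero z)) atTop (𝓝 p₀) ∧
      Tendsto (D.spectralData.partialProd (D.spectralData.bFactorNonzero L z)) atTop (𝓝 p₁) ∧
      (s z / t z) ^ 4 = -(p₀ * p₁) := by
  have hpi := piNorm_ne_zero hL.ne'
  have hζ := zeta_sub_ne_zero hL hz
  have hinv := ((D.nearOne_zetaPair hL z true).mul (D.nearOne_zetaPair hL z false)).inv
  have hmu := (D.nearOne_mu hL z).mul (D.nearOne_mu hL z)
  obtain ⟨l₀, hl₀⟩ := hB.exists_tendsto (fun j => D.nu j = 0) (by simp)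
  obtain ⟨l₁, hl₁⟩ := hB.exists_tendsto (fun j => D.nu j ≠ 0) (by simp)
  obtain ⟨p₀, hp₀⟩ := (hmu.mul hinv).exists_tendsto_prod (fun j => D.nu j = 0) (by convert hl₀)
  obtain ⟨p₁, hp₁⟩ := hinv.exists_tendsto_prod (fun j => D.nu j ≠ 0) (by convert hl₁)
  have e₀ : Tendsto (D.spectralData.partialProd (D.spectralData.bFactorZero z)) atTop (𝓝 p₀) := by
    refine hp₀.congr fun N => ?_
    rw [partialProd_bFactorZero hL hz]
    refine Finset.prod_congr (by congr) fun j _ => ?_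
    have h1 := hζ (2 * j)
    have h2 := hζ (2 * j - 1)
    have h3 := hpi j
    simp only [zetaPair, if_true, Bool.false_eq_true, if_false]
    field_simp
  have e₁ : Tendsto (D.spectralData.partialProd (D.spectralData.bFactorNonzero L z)) atTop
      (𝓝 p₁) := by
    refine hp₁.congr fun N => ?_
    rw [partialProd_bFactorNonzero]
    refine Finset.prod_congr (by congr) fun j _ => ?_
    have h1 := hζ (2 * j)
    have h2 := hζ (2 * j - 1)
    have h3 := hpi j
    simp only [zetaPair, if_true, Bool.false_eq_true, if_false]
    field_simp
  refine ⟨p₀, p₁, e₀, e₁, ?_⟩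
  -- Already for finite N, the two products times that for -(Δ² - 1) collapse to the square of the
  -- Dirichlet product over ν = 0. In the limit -p₀p₁(Δ² - 1) = (f⁰)², which is the formula for b⁴.
  have hlim := (e₀.mul e₁).mul (tendsto_prod_zeta hL hz)
  have hlim' := (hB.tendsto_dirichletPartial hL 0 z).pow 2
  have hfin : ∀ N, D.spectralData.partialProd (D.spectralData.bFactorZero z) N *
      D.spectralData.partialProd (D.spectralData.bFactorNonzero L z) N *
      ∏ j ∈ Finset.Icc (-(N : ℤ)) N,
        ((D.zeta (2 * j) - z) / piNorm L j * ((D.zeta (2 * j - 1) - z) / piNorm L j)) =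
      D.dirichletPartial 0 z N ^ 2 := by
    intro N
    rw [partialProd_bFactorZero hL hz, partialProd_bFactorNonzero, dirichletPartial]
    simp only [Finset.prod_filter]
    rw [← Finset.prod_mul_distrib, ← Finset.prod_mul_distrib, ← Finset.prod_pow]
    refine Finset.prod_congr rfl fun j _ => ?_
    have h1 := hζ (2 * j)
    have h2 := hζ (2 * j - 1)
    have h3 := hpi j
    by_cases h : D.nu j = 0
    · simp only [h, if_true, ne_eq, not_true_eq_false, if_false]
      field_simp
    · simp only [h, if_true, ne_eq, not_false_eq_true, if_false]
      field_simp
  have heq := tendsto_nhds_unique (hlim.congr hfin) hlim'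
  have hΔ := discriminant_sq_sub_one_ne_zero hL hz
  have hs' := hs z hz
  rw [f0] at hs'
  have e4 : (s z / t z) ^ 4 = (s z ^ 2) ^ 2 / (t z ^ 2) ^ 2 := by
    rw [div_pow, ← pow_mul, ← pow_mul]
  rw [e4, hs', ht z hz, D.r_sq, neg_sq, ← heq]
  field_simp

variable {D} in
-- The three sign classes partition the labels, so the finite products regroup; the minus sign in f⁰
-- absorbs the one in the product for ỹ₁₂.
theorem BalancedSigns.f0_mul_fPlus_mul_fMinus (hB : D.BalancedSigns) (hL : 0 < L) {z : ℂ}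
    (hz : z ∉ D.spectrum) : D.f0 z * D.fPlus z * D.fMinus z = D.y12 z := by
  have h := fun ε => hB.tendsto_dirichletPartial hL ε z
  have hfin : ∀ N, D.dirichletPartial 0 z N * D.dirichletPartial 1 z N *
      D.dirichletPartial (-1) z N =
      ∏ j ∈ Finset.Icc (-(N : ℤ)) N, (D.mu j - z) / piNorm L j := by
    intro N
    simp only [dirichletPartial, Finset.prod_filter]
    rw [← Finset.prod_mul_distrib, ← Finset.prod_mul_distrib]
    refine Finset.prod_congr rfl fun j _ => ?_
    rcases D.nu_mem j with h | h | h <;> simp [h]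
  have := tendsto_nhds_unique ((((h 0).mul (h 1)).mul (h (-1))).congr hfin)
    (tendsto_prod_mu hL hz)
  rw [f0, fPlus, fMinus]
  linear_combination -this

variable {D} in
theorem BalancedSigns.sq_mul_fPlus_mul_fMinus (hB : D.BalancedSigns) (hL : 0 < L) {s t : ℂ → ℂ}
    (hs : D.IsRootF0 s) (ht : D.IsFourthRoot t) {z : ℂ} (hz : z ∉ D.spectrum) :
    (s z / t z) ^ 2 * D.fPlus z * D.fMinus z = D.y12 z / D.r z := by
  rw [div_pow, hs z hz, ht z hz, ← hB.f0_mul_fPlus_mul_fMinus hL hz]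
  ring

/-- Nonzero signs can be read off from the spectral data alone. Phrasing this through the structure
lets an equality of data be rewritten despite its dependent types. -/
theorem nu_eq_iff_spectralData {ε : ℤ} (hε : ε ≠ 0) (k : ℤ) :
    D.nu k = ε ↔ ∃ h : k ∈ D.spectralData.idx, D.spectralData.nu ⟨k, h⟩ = ε := by
  constructor
  · intro h
    refine ⟨fun hk => hε ?_, h⟩
    rw [← h, D.nu_eq_zero_of_degenerate hk]
  · rintro ⟨_, h⟩
    exact h

variable {D} in
theorem BalancedSigns.of_spectralData_eq (hB : D.BalancedSigns) {D' : FloquetData L}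
    (h : D'.spectralData = D.spectralData) : D'.BalancedSigns := by
  intro ε hε
  obtain ⟨l, hl⟩ := hB ε hε
  refine ⟨l, hl.congr fun N => ?_⟩
  have hε0 : ε ≠ 0 := by rcases hε with rfl | rfl <;> norm_num
  have e : ∀ k, D.nu k = ε ↔ D'.nu k = ε := fun k => by
    rw [D.nu_eq_iff_spectralData hε0, D'.nu_eq_iff_spectralData hε0, h]
  simp only [e]

theorem B_eq_smul_of_eq {D' : FloquetData L} {b b' : ℂ → ℂ} {z ω : ℂ} (hb : b' z = ω * b z)
    (hp : D'.fPlus z = D.fPlus z) (hm : D'.fMinus z = D.fMinus z) :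
    D'.B b' z = ω • D.B b z := by
  rw [B, B, hp, hm, hb]
  split_ifs
  · rw [smul_smul, mul_assoc]
  · rw [smul_smul]

variable {D} in
/-- The spectral data determine `B` up to the choice of branches. -/
theorem BalancedSigns.exists_B_eq_smul (hB : D.BalancedSigns) (hL : 0 < L) {s t : ℂ → ℂ}
    (hs : D.IsRootF0 s) (ht : D.IsFourthRoot t) {D' : FloquetData L} {s' t' : ℂ → ℂ}
    (hs' : D'.IsRootF0 s') (ht' : D'.IsFourthRoot t') (h : D'.spectralData = D.spectralData)
    {z : ℂ} (hz : z ∉ D.spectrum) (hz' : z ∉ D'.spectrum) :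
    ∃ ω : ℂ, ω ^ 4 = 1 ∧
      D'.B (fun w => s' w / t' w) z = ω • D.B (fun w => s w / t w) z := by
  have hB' := hB.of_spectralData_eq h
  have hf : ∀ ε : ℤ, ε ≠ 0 → D'.dirichletProd ε z = D.dirichletProd ε z := fun ε hε => by
    have h1 := (hB'.tendsto_dirichletPartial hL ε z).congr fun N =>
      (D'.partialProd_fFactor hε z N).symm
    rw [h] at h1
    exact tendsto_nhds_unique h1 ((hB.tendsto_dirichletPartial hL ε z).congr fun N =>
      (D.partialProd_fFactor hε z N).symm)
  have h4 : (s' z / t' z) ^ 4 = (s z / t z) ^ 4 := by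
    obtain ⟨p₀, p₁, h0, h1, h2⟩ := hB.exists_prod_eq hL hs ht hz
    obtain ⟨p₀', p₁', h0', h1', h2'⟩ := hB'.exists_prod_eq hL hs' ht' hz'
    rw [h] at h0' h1'
    rw [h2, h2', tendsto_nhds_unique h0 h0', tendsto_nhds_unique h1 h1']
  by_cases hb : s z / t z = 0
  -- Equal fourth powers force both values of b to vanish together; otherwise their quotient is the
  -- required root of unity.
  · refine ⟨1, one_pow 4, D.B_eq_smul_of_eq ?_ (hf 1 one_ne_zero) (hf (-1) (by norm_num))⟩
    rw [hb, zero_pow four_ne_zero, pow_eq_zero_iff four_ne_zero] at h4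
    rw [h4, hb, mul_zero]
  · refine ⟨(s' z / t' z) / (s z / t z), ?_,
      D.B_eq_smul_of_eq ?_ (hf 1 one_ne_zero) (hf (-1) (by norm_num))⟩
    · rw [div_pow, h4, div_self (pow_ne_zero _ hb)]
    · rw [div_mul_cancel₀ _ hb]

theorem dirichletProd_eq_one {ε : ℤ} (h : ∀ k, D.nu k ≠ ε) (z : ℂ) : D.dirichletProd ε z = 1 := by
  refine Tendsto.limUnder_eq (tendsto_const_nhds.congr fun N => ?_)
  rw [dirichletPartial, Finset.filter_false_of_mem (fun j _ => h j), Finset.prod_empty]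

theorem exists_B_eq_smul_one (h : ∀ k, D.nu k = 0) (b : ℂ → ℂ) (z : ℂ) :
    ∃ c : ℂ, D.B b z = c • (1 : Matrix (Fin 2) (Fin 2) ℂ) := by
  have hp : D.fPlus z = 1 := D.dirichletProd_eq_one (fun k => by simp [h k]) z
  have hm : D.fMinus z = 1 := D.dirichletProd_eq_one (fun k => by simp [h k]) z
  have h1 : Matrix.diagonal ![(1 : ℂ), 1] = 1 := by
    ext i j
    fin_cases i <;> fin_cases j <;> simp
  rw [B, hp, hm, h1]
  split_ifs
  · exact ⟨_, rfl⟩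
  · exact ⟨_, rfl⟩

end FloquetData

end ZS

end

theorem proposition4p1 {L : ℝ} (hL : 0 < L) (D : ZS.FloquetData L) (s t : ℂ → ℂ)
    (hs : D.IsRootF0 s) (ht : D.IsFourthRoot t) :
    (D.BalancedSigns →
      (∀ (ε : ℤ) (z : ℂ),
        Tendsto (D.dirichletPartial ε z) atTop (𝓝 (D.dirichletProd ε z))) ∧
      (∀ z : ℂ, Tendsto (D.spectralData.partialProd (D.spectralData.fFactor L 1 z)) atTop
        (𝓝 (D.fPlus z))) ∧
      (∀ z : ℂ, Tendsto (D.spectralData.partialProd (D.spectralData.fFactor L (-1) z)) atTop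
        (𝓝 (D.fMinus z))) ∧
      (∀ z : ℂ, z ∉ D.spectrum → ∃ p₀ p₁ : ℂ,
        Tendsto (D.spectralData.partialProd (D.spectralData.bFactorZero z)) atTop (𝓝 p₀) ∧
        Tendsto (D.spectralData.partialProd (D.spectralData.bFactorNonzero L z)) atTop (𝓝 p₁) ∧
        (s z / t z) ^ 4 = -(p₀ * p₁)) ∧
      (∀ (D' : ZS.FloquetData L) (s' t' : ℂ → ℂ), D'.IsRootF0 s' → D'.IsFourthRoot t' →
        D'.spectralData = D.spectralData →
        ∀ z : ℂ, z ∉ D.spectrum → z ∉ D'.spectrum → ∃ ω : ℂ, ω ^ 4 = 1 ∧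
          D'.B (fun w => s' w / t' w) z = ω • D.B (fun w => s w / t w) z) ∧
      (∀ z : ℂ, z ∉ D.spectrum →
        (0 < z.im → (D.B (fun w => s w / t w) z).det = -(D.y12 z / D.r z)) ∧
        (z.im < 0 → (D.B (fun w => s w / t w) z).det = D.y12 z / D.r z))) ∧
    ((∀ x : ℝ, (D.q x).im = 0) → (∀ x : ℝ, D.q (-x) = D.q x) →
      ∀ z : ℂ, z ∉ D.spectrum → ∃ c : ℂ,
        D.B (fun w => s w / t w) z = c • (1 : Matrix (Fin 2) (Fin 2) ℂ)) := by
  refine ⟨fun hB => ⟨fun ε z => hB.tendsto_dirichletPartial hL ε z, fun z => ?_, fun z => ?_,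
    fun z hz => hB.exists_prod_eq hL hs ht hz, fun D' s' t' hs' ht' h z hz hz' =>
      hB.exists_B_eq_smul hL hs ht hs' ht' h hz hz', fun z hz => ⟨fun hpos => ?_, fun hneg => ?_⟩⟩,
    fun hreal heven z _ =>
      D.exists_B_eq_smul_one (D.nu_eq_zero_of_real_even hreal heven hL) _ z⟩
  · exact (hB.tendsto_dirichletPartial hL 1 z).congr fun N =>
      (D.partialProd_fFactor one_ne_zero z N).symm
  · exact (hB.tendsto_dirichletPartial hL (-1) z).congr fun N =>
      (D.partialProd_fFactor (by norm_num) z N).symm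
  -- In the upper half-plane the scalar is i b, and i² supplies the minus sign that distinguishes
  -- the two determinants.
  · have hI : I ^ 2 = -1 := I_sq
    rw [ZS.FloquetData.B, if_pos hpos, Matrix.det_smul, Matrix.det_diagonal,
      ← hB.sq_mul_fPlus_mul_fMinus hL hs ht hz]
    simp only [Fintype.card_fin, Fin.prod_univ_two, Matrix.cons_val_zero, Matrix.cons_val_one]
    linear_combination ((s z / t z) ^ 2 * D.fPlus z * D.fMinus z) * hI
  · rw [ZS.FloquetData.B, if_neg hneg.not_gt, Matrix.det_smul, Matrix.det_diagonal,
      ← hB.sq_mul_fPlus_mul_fMinus hL hs ht hz]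
    simp only [Fintype.card_fin, Fin.prod_univ_two, Matrix.cons_val_zero, Matrix.cons_val_one]
    ring
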